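/- **Notation.** $\mathrm{NSym}$ is the free associative $\mathbb{Q}$-algebra on $H_1,H_2,\dots$, with $H_0=1$ and $H_m=0$ for $m<0$. For a composition $\alpha=(\alpha_1,\dots,\alpha_k)$ (a finite, possibly empty, sequence of positive integers) of length $\ell(\alpha)=k$, the immaculate function is $$\mathfrak S_\alpha=\sum_{\sigma\in S_k}(-1)^\sigma H_{\alpha_1+\sigma_1-1}\cdots H_{\alpha_k+\sigma_k-k}.$$ These functions form a basis of $\mathrm{NSym}$, and $C_{\alpha,\beta}^{\gamma}$ is defined by $\mathfrak S_\alpha\mathfrak S_\beta=\sum_\gamma C_{\alpha,\beta}^\gamma\mathfrak S_\gamma$. Let $\beta$ be a composition of length $n$. A skew tableau of inner shape $(1)$ has left-justified rows of positive integers, the first row beginning with one empty cell and all others non-empty; its outer shape counts the empty cell. It is immaculate if its rows are weakly increasing and the first entries of the rows below the first row are strictly increasing from top to bottom. Let $\mathfrak T_{(1)}^\beta$ be the set of immaculate skew tableaux $T$ of inner shape $(1)$ with entries in $\{1,\dots,n\}$ such that $\sigma(T):=c(T)-\beta+(1,2,\dots,n)$ is a permutation in one-line notation, where $c(T)_i$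 is the number of $i$'s in $T$. Let $\delta(T)=(s+1,\delta_1,\dots,\delta_n)$, where $s$ is the number of non-empty cells of the first row and $\delta_i$ is the length of the row below the first one that starts with $i$ ($0$ if there is none). Row $i+1$ of $T$ below means this row (rows of length $0$ are kept), and row $1$ is the first row. Let $\mathrm{comp}(\delta)$ be $\delta$ with its zeros removed, and $\mathrm{sgn}(v)=(-1)^{\#\{i:\,v_i<0\}}$. Put $Q_i=s+\sum_{j<i}(\delta_j-\beta_j)$. Let $Z_\beta^\gamma$ be the set of all vectors $\delta=\delta(T)$ with $\mathrm{comp}(\delta)=\gamma$, where $T\in\mathfrak T_{(1)}^\beta$ satisfies, with $\sigma=\sigma(T)$, for all $1\le i\le n$: 1. if $\beta_i<Q_i$, then $\beta_i<\delta_i$, $\sigma(i)=i+1$ and all $i$'s of $T$ are in row $i+1$; 2. if $\beta_i>Q_i$, then $\beta_i\ge\delta_i\ge\beta_i-Q_i$, $\sigma(i)=\max\{k+1: 0\le k<i,\ k=0\text{ or }\sigma(k)\ne k+1\}$, and all entries of $T$ above row $i+1$ are in $\{1,\dots,i\}$; 3. if $\beta_i=Q_i$, then either (a) the conclusion of 1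 holds, or (b) $\delta_i=0$, $\sigma(i)$ is as in 2, and for all $i<j\le n$: $\beta_j=\delta_j$, $\sigma(j)=j$ and all $j$'s are in row $j+1$. For a composition $\gamma$ with $\ell(\gamma)=n\ge1$, let $k$ be the smallest integer with $1\le k\le n$ and $\beta_j=\gamma_j$ for all $k<j\le n$, and let $r$ be the largest integer with $k\le r\le n$ and $\beta_j<\beta_{j+1}$ for all $k\le j<r$. **Theorem (left Pieri rule).** For every composition $\beta$ of length $n$ (in particular for every partition), $\mathfrak S_{(1)}\mathfrak S_\beta=\sum_\gamma C_{(1),\beta}^\gamma\mathfrak S_\gamma$ with $$C_{(1),\beta}^{\gamma}=\begin{cases}\mathrm{sgn}(\beta_1-\gamma_2,\dots,\beta_n-\gamma_{n+1})&\text{if }\ell(\gamma)=n+1\text{ and }\gamma\in Z_\beta^\gamma,\\ \mathrm{sgn}(\beta_1-\gamma_2,\dots,\beta_{k-1}-\gamma_k)&\text{if }\ell(\gamma)=n\geq 1,\ r-k\text{ is even and }(\gamma_1,\dots,\gamma_k,0,\gamma_{k+1},\dots,\gamma_n)\in Z_\beta^\gamma,\\0&\text{otherwise.}\end{cases}$$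 In particular $C_{(1),\beta}^\gamma\in\{-1,0,1\}$: the rule is multiplicity-free. Moreover: - A vector $\delta=(s+1,\delta_1,\dots,\delta_n)$ of non-negative integers is in $Z_\beta^\gamma$ if and only if $s\ge0$, the sum of the entries of $\delta$ is $|\beta|+1$, $\mathrm{comp}(\delta)=\gamma$, and for all $1\le i\le n$: $\beta_i<\delta_i$ if $\beta_i<Q_i$; $\beta_i\ge\delta_i\ge\beta_i-Q_i$ if $\beta_i>Q_i$; and, if $\beta_i=Q_i$, either $\beta_i<\delta_i$, or $\delta_i=0$ and $\beta_j=\delta_j$ for all $i<j\le n$. - For each $\delta\in Z_\beta^\gamma$ there is exactly one $T\in\mathfrak T_{(1)}^\beta$ with $\delta(T)=\delta$ that satisfies 1--3; it has outer shape $\gamma$, and the sign of the permutation $\sigma(T)$ is $\mathrm{sgn}(\beta_1-\delta_1,\dots,\beta_n-\delta_n)$. -/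

import Mathlib

/-- Compositions, of all sizes: finite lists of positive integers. The empty list is the
composition of `0`. -/
abbrev Comp : Type := List ℕ+

/-- The `i`-th part `α_i` of a composition, with `i ≥ 1`; it is `0` for `i > ℓ(α)`.
(The value at `i = 0` is `0` and carries no meaning.) -/
def Comp.part (α : Comp) (i : ℕ) : ℕ := (0 :: α.map PNat.val).getD i 0

/-- The size `|α|`. -/
def Comp.size (α : Comp) : ℕ := (α.map PNat.val).sum

/-- The algebra of non-commutative symmetric functions: the free associative `ℚ`-algebra on
generators `H_1, H_2, …`. -/
abbrev NSym : Type := FreeAlgebra ℚ ℕ+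

namespace NSym

/-- `H_m` for every integer `m`, with `H_0 = 1` and `H_m = 0` for `m < 0`. -/
noncomputable def H (m : ℤ) : NSym :=
  if h : 0 < m.toNat then FreeAlgebra.ι ℚ ⟨m.toNat, h⟩ else if m = 0 then 1 else 0

/-- The immaculate function
`𝔖_α = ∑_{σ ∈ S_k} (-1)^σ H_{α_1 + σ_1 - 1} ⋯ H_{α_k + σ_k - k}`, with `k = ℓ(α)`. -/
noncomputable def immaculate (α : Comp) : NSym :=
  ∑ σ : Equiv.Perm (Fin α.length), (Equiv.Perm.sign σ : ℤ) •
    (List.ofFn fun i : Fin α.length => H ((α.get i : ℤ) + (σ i : ℤ) - (i : ℤ))).prod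

section Basis

/-- The monomial `H_α = H_{α_1} ⋯ H_{α_k}`. -/
noncomputable def mono (α : Comp) : NSym := (α.map (FreeAlgebra.ι ℚ)).prod

/-- The monomials form a basis. -/
noncomputable def monoBasis : Module.Basis Comp ℚ NSym := FreeAlgebra.basisFreeMonoid ℚ ℕ+

theorem monoBasis_apply (α : Comp) : monoBasis α = mono α := by
  have h : monoBasis α = (FreeAlgebra.equivMonoidAlgebraFreeMonoid (R := ℚ) (X := ℕ+)).symm
      (MonoidAlgebra.single (FreeMonoid.ofList α) 1) := by
    rfl
  rw [h, AlgEquiv.symm_apply_eq]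
  unfold mono
  induction α with
  | nil => simp [MonoidAlgebra.one_def]
  | cons a l ih =>
    have : FreeMonoid.ofList (a :: l) = FreeMonoid.of a * FreeMonoid.ofList l := rfl
    have h0 : monoBasis l = (FreeAlgebra.equivMonoidAlgebraFreeMonoid (R := ℚ) (X := ℕ+)).symm
      (MonoidAlgebra.single (FreeMonoid.ofList l) 1) := by rfl
    rw [List.map_cons, List.prod_cons, map_mul, ← ih h0, this]
    simp [FreeAlgebra.equivMonoidAlgebraFreeMonoid, MonoidAlgebra.single_mul_single]

/-- The statistic `∑ i, i * l_i` (with `i` from `0`), by recursion. -/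
def rk : List ℤ → ℤ
  | [] => 0
  | _ :: l => rk l + l.sum

/-- The statistic `rk` of a composition. -/
def crk (α : Comp) : ℤ := rk (α.map fun a : ℕ+ => ((a : ℕ) : ℤ))

theorem csum_nonneg (α : Comp) : 0 ≤ (α.map fun a : ℕ+ => ((a : ℕ) : ℤ)).sum := by
  induction α with
  | nil => simp
  | cons a l ih => simp only [List.map_cons, List.sum_cons]; positivity

theorem crk_nonneg (α : Comp) : 0 ≤ crk α := by
  induction α with
  | nil => simp [crk, rk]
  | cons a l ih => have := csum_nonneg l; simp only [crk, List.map_cons, rk] at ih ⊢; omega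

theorem prod_H (l : List ℤ) : (l.map H).prod = 0 ∨ ∃ m : Comp, (l.map H).prod = mono m ∧
    (m.map fun a : ℕ+ => ((a : ℕ) : ℤ)).sum = l.sum ∧ crk m ≤ rk l := by
  induction l with
  | nil => exact Or.inr ⟨[], by simp [mono, crk, rk]⟩
  | cons a l ih =>
    rcases ih with h | ⟨m, h1, h2, h3⟩
    · left; simp [h]
    · by_cases ha : 0 < a.toNat
      · right
        refine ⟨⟨a.toNat, ha⟩ :: m, ?_, ?_, ?_⟩
        · rw [List.map_cons, List.prod_cons, h1]
          simp only [H, ha, dite_true, mono]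
          rfl
        · change ((a.toNat : ℕ) : ℤ) + (m.map fun a : ℕ+ => ((a : ℕ) : ℤ)).sum = a + l.sum
          omega
        · change crk m + (m.map fun a : ℕ+ => ((a : ℕ) : ℤ)).sum ≤ rk l + l.sum
          omega
      · by_cases h0 : a = 0
        · right
          refine ⟨m, ?_, ?_, ?_⟩
          · simp [h0, H, h1]
          · simp [h0, h2]
          · have := csum_nonneg m
            simp only [rk]; omega
        · left; simp [H, ha, h0]

theorem rk_ofFn {n : ℕ} (v : Fin n → ℤ) : rk (List.ofFn v) = ∑ i : Fin n, (i : ℤ) * v i := by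
  induction n with
  | zero => simp [rk]
  | succ n ih =>
    rw [List.ofFn_succ, rk, ih, Fin.sum_univ_succ, List.sum_ofFn, ← Finset.sum_add_distrib]
    simp only [Fin.val_zero, Nat.cast_zero, zero_mul, zero_add, Fin.val_succ, Nat.cast_add,
      Nat.cast_one]
    exact Finset.sum_congr rfl fun i _ => by ring

theorem perm_lt {n : ℕ} {σ : Equiv.Perm (Fin n)} (h : σ ≠ 1) :
    ∑ i : Fin n, (i : ℤ) * ((σ i : ℤ) - i) < 0 := by
  obtain ⟨j, hj⟩ : ∃ j, σ j ≠ j := by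
    by_contra! hc
    exact h (Equiv.ext hc)
  have hpos : 0 < ∑ i : Fin n, ((σ i : ℤ) - i) ^ 2 := by
    refine Finset.sum_pos' (fun i _ => sq_nonneg _) ⟨j, Finset.mem_univ _, ?_⟩
    have : ((σ j : ℕ) : ℤ) - (j : ℕ) ≠ 0 := by
      intro h0
      exact hj (Fin.ext (by omega))
    positivity
  have hsq : ∑ i : Fin n, ((σ i : ℕ) : ℤ) ^ 2 = ∑ i : Fin n, ((i : ℕ) : ℤ) ^ 2 :=
    Equiv.sum_comp σ fun i : Fin n => ((i : ℕ) : ℤ) ^ 2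
  have hexp : ∑ i : Fin n, ((σ i : ℤ) - i) ^ 2 = ∑ i : Fin n, ((σ i : ℕ) : ℤ) ^ 2
      - ∑ i : Fin n, ((i : ℕ) : ℤ) ^ 2 - 2 * ∑ i : Fin n, (i : ℤ) * ((σ i : ℤ) - i) := by
    rw [Finset.mul_sum, ← Finset.sum_sub_distrib, ← Finset.sum_sub_distrib]
    exact Finset.sum_congr rfl fun i _ => by ring
  linarith

/-- Unitriangularity of the immaculate functions over the monomials. -/
theorem repr_immaculate (α m : Comp) (hm : crk α ≤ crk m) :
    monoBasis.repr (immaculate α) m = if m = α then 1 else 0 := by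
  classical
  have hcrk : crk α = ∑ i : Fin α.length, (i : ℤ) * (α.get i : ℤ) := by
    rw [← rk_ofFn, crk]
    congr 1
    apply List.ext_get <;> simp
  unfold immaculate
  rw [map_sum, Finsupp.finsetSum_apply, Finset.sum_eq_single 1]
  · have : (List.ofFn fun i : Fin α.length =>
        H ((α.get i : ℤ) + (((1 : Equiv.Perm (Fin α.length)) i : Fin _) : ℤ) - (i : ℤ))).prod
        = monoBasis α := by
      rw [monoBasis_apply, mono]
      congr 1
      apply List.ext_get
      · simp
      · intro i h1 h2
        simp [H]
        rfl
    rw [this]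
    simp [Finsupp.single_apply, eq_comm]
  · intro σ _ hσ
    have key := prod_H (List.ofFn fun i : Fin α.length =>
      ((α.get i : ℤ) + (σ i : ℤ) - (i : ℤ)))
    rw [List.map_ofFn] at key
    change (List.ofFn fun i : Fin α.length =>
      H ((α.get i : ℤ) + (σ i : ℤ) - (i : ℤ))).prod = 0 ∨ ∃ m : Comp,
        (List.ofFn fun i : Fin α.length =>
          H ((α.get i : ℤ) + (σ i : ℤ) - (i : ℤ))).prod = mono m ∧ _ at key
    rcases key with h | ⟨m', h1, -, h3⟩
    · rw [h, smul_zero, map_zero, Finsupp.zero_apply]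
    · rw [h1, ← monoBasis_apply, map_zsmul, Module.Basis.repr_self]
      have hne : m' ≠ m := by
        rintro rfl
        rw [rk_ofFn] at h3
        have h4 := perm_lt hσ
        have h5 : ∑ i : Fin α.length, (i : ℤ) * ((α.get i : ℤ) + (σ i : ℤ) - (i : ℤ))
            = ∑ i : Fin α.length, (i : ℤ) * (α.get i : ℤ)
              + ∑ i : Fin α.length, (i : ℤ) * ((σ i : ℤ) - i) := by
          rw [← Finset.sum_add_distrib]
          exact Finset.sum_congr rfl fun i _ => by ring
        omega
      simp [hne]
  · simp

theorem linearIndependent_immaculate : LinearIndependent ℚ immaculate := by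
  classical
  rw [linearIndependent_iff]
  intro c hc
  by_contra hne
  obtain ⟨m, hm, hmax⟩ := c.support.exists_max_image crk (Finsupp.support_nonempty_iff.2 hne)
  have h := congrArg (fun x => monoBasis.repr x m) hc
  simp only [Finsupp.linearCombination_apply, Finsupp.sum, map_sum, map_smul,
    Finsupp.finsetSum_apply, Finsupp.smul_apply, map_zero, Finsupp.zero_apply] at h
  rw [Finset.sum_congr rfl fun j hj => by rw [repr_immaculate j m (hmax j hj)]] at h
  simp at h
  exact (Finsupp.mem_support_iff.1 hm) h

theorem span_immaculate : ⊤ ≤ Submodule.span ℚ (Set.range immaculate) := by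
  rw [← monoBasis.span_eq, Submodule.span_le]
  rintro _ ⟨α, rfl⟩
  induction hN : (crk α).toNat using Nat.strong_induction_on generalizing α with
  | _ N ih =>
    have hdec : monoBasis α = immaculate α - (immaculate α - monoBasis α) := by abel
    rw [hdec]
    refine Submodule.sub_mem _ (Submodule.subset_span ⟨α, rfl⟩) ?_
    rw [← monoBasis.linearCombination_repr (immaculate α - monoBasis α),
      Finsupp.linearCombination_apply]
    refine Submodule.sum_mem _ fun m hm => Submodule.smul_mem _ _ ?_
    refine ih (crk m).toNat ?_ m rfl
    by_contra hlt
    have h1 := crk_nonneg m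
    have h2 := crk_nonneg α
    rw [Finsupp.mem_support_iff, map_sub, Finsupp.sub_apply,
      repr_immaculate α m (by omega)] at hm
    simp [Finsupp.single_apply, eq_comm] at hm

end Basis

/-- The basis of immaculate functions, indexed by compositions. -/
noncomputable def immaculateBasis : Module.Basis Comp ℚ NSym :=
  Module.Basis.mk linearIndependent_immaculate span_immaculate

/-- The structure constants `C_{α,β}^γ`: the coefficients of `𝔖_α 𝔖_β` in the basis of
immaculate functions, as a finitely supported function of `γ`. -/
noncomputable def structureConst (α β : Comp) : Comp →₀ ℚ :=
  immaculateBasis.repr (immaculate α * immaculate β)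

end NSym

/-- A skew tableau with inner shape `α`, given by the entries of its rows. Row number `i` (from
`0`) starts with `α_{i+1}` empty cells (none if `i ≥ ℓ(α)`), followed by the entries listed in
`rows`. All the rows of `α` are present, and a row without empty cells has an entry. -/
structure SkewTableau (α : Comp) where
  rows : List (List ℕ)
  entry_pos : ∀ r ∈ rows, ∀ x ∈ r, 0 < x
  length_le : α.length ≤ rows.length
  ne_nil : ∀ r ∈ rows.drop α.length, r ≠ []

namespace SkewTableau

/-- The outer shape: the lengths of the rows, empty cells included. -/
def shape {α : Comp} (T : SkewTableau α) : List ℕ :=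
  T.rows.mapIdx fun i r => α.part (i + 1) + r.length

/-- Rows are weakly increasing and the first column (the first cells of those rows that have no
empty cell) is strictly increasing. -/
def IsImmaculate {α : Comp} (T : SkewTableau α) : Prop :=
  (∀ r ∈ T.rows, r.SortedLE) ∧
    ((T.rows.drop α.length).map fun r => r.headD 0).SortedLT

/-- The number of times `i` occurs in `T`. -/
def content {α : Comp} (T : SkewTableau α) (i : ℕ) : ℕ := T.rows.flatten.count i

/-- The `i`-th entry (`i ≥ 1`) of `σ(T) = c(T) - β + (1, 2, …, n)`. -/
def sigma {α : Comp} (β : Comp) (T : SkewTableau α) (i : ℕ) : ℤ :=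
  (T.content i : ℤ) - β.part i + i

/-- `σ(T)` is the one-line notation of the permutation `π` of `{1, …, n}`
(an element `i : Fin n` stands for `i + 1`). -/
def HasPerm {α : Comp} (β : Comp) (T : SkewTableau α) (π : Equiv.Perm (Fin β.length)) : Prop :=
  ∀ i : Fin β.length, T.sigma β (i + 1) = (π i : ℤ) + 1

/-- The set `𝔗_α^β` of skew immaculate tableaux of inner shape `α`, with entries in
`{1, …, ℓ(β)}`, for which `c(T) - β + (1, 2, …, ℓ(β))` is a permutation. -/
def permTableaux (α β : Comp) : Set (SkewTableau α) :=
  {T | T.IsImmaculate ∧ (∀ r ∈ T.rows, ∀ x ∈ r, x ≤ β.length) ∧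
    ∃ π : Equiv.Perm (Fin β.length), T.HasPerm β π}

/-- For inner shape `(1)`: block number `0` is the (non-empty cells of the) first row, and block
number `i ≥ 1` is the row below the first one that starts with `i`, or empty if there is none. -/
def block (T : SkewTableau [1]) (i : ℕ) : List ℕ :=
  if i = 0 then T.rows.headD []
  else (T.rows.tail.find? fun r => r.head? == some i).getD []

/-- The vector `δ(T) = (s + 1, δ_1, …, δ_n)`: `s` is the number of non-empty cells of the first
row and `δ_i` the length of the row that starts with `i`. -/
def delta (n : ℕ) (T : SkewTableau [1]) : List ℕ :=
  ((T.block 0).length + 1) :: (List.range n).map fun i => (T.block (i + 1)).length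

/-- All occurrences of `i` in the blocks `0, …, n` are in block `i`. -/
def OnlyInOwnBlock (n : ℕ) (T : SkewTableau [1]) (i : ℕ) : Prop :=
  ∀ m ≤ n, m ≠ i → i ∉ T.block m

end SkewTableau

/-- `s + ∑_{j=1}^{i-1} (δ_j - β_j)` for a vector `δ = (s + 1, δ_1, …, δ_n)`. -/
def excess (β : Comp) (δ : List ℕ) (i : ℕ) : ℤ :=
  ((δ.getD 0 0 : ℤ) - 1) + ∑ j ∈ Finset.Ico 1 i, ((δ.getD j 0 : ℤ) - β.part j)

namespace SkewTableau

/-- `σ(T)(i)` is the maximum of all `k + 1` with `k < i` such that `k = 0` or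
`σ(T)(k) ≠ k + 1`. -/
def SigmaLow (β : Comp) (T : SkewTableau [1]) (i : ℕ) : Prop :=
  IsGreatest {m : ℤ | ∃ k < i, m = k + 1 ∧ (k = 0 ∨ T.sigma β k ≠ k + 1)} (T.sigma β i)

/-- `β_i < δ_i`, `σ(T)(i) = i + 1`, and all the `i`'s are in block `i`. -/
def CaseHigh (β : Comp) (T : SkewTableau [1]) (i : ℕ) : Prop :=
  β.part i < (T.delta β.length).getD i 0 ∧ T.sigma β i = i + 1 ∧ T.OnlyInOwnBlock β.length i

/-- `δ_i = 0`, `σ(T)(i)` is as in `SigmaLow`, and for all `i < j ≤ n`: `β_j = δ_j`,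
`σ(T)(j) = j`, and all the `j`'s are in block `j`. -/
def CaseZero (β : Comp) (T : SkewTableau [1]) (i : ℕ) : Prop :=
  (T.delta β.length).getD i 0 = 0 ∧ T.SigmaLow β i ∧
    ∀ j, i < j → j ≤ β.length → β.part j = (T.delta β.length).getD j 0 ∧
      T.sigma β j = j ∧ T.OnlyInOwnBlock β.length j

/-- The conditions on a tableau `T ∈ 𝔗_{(1)}^β` that single out the surviving tableaux. Rows are
counted as in `δ(T)`: block `i` is row `i + 1` of `T` if rows of length `0` are kept. -/
def Survives (β : Comp) (T : SkewTableau [1]) : Prop :=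
  ∀ i, 1 ≤ i → i ≤ β.length →
    ((β.part i : ℤ) < excess β (T.delta β.length) i → T.CaseHigh β i) ∧
    (excess β (T.delta β.length) i < β.part i →
      (T.delta β.length).getD i 0 ≤ β.part i ∧
      (β.part i : ℤ) - excess β (T.delta β.length) i ≤ (T.delta β.length).getD i 0 ∧
      T.SigmaLow β i ∧ ∀ m < i, ∀ x ∈ T.block m, x ≤ i) ∧
    ((β.part i : ℤ) = excess β (T.delta β.length) i → T.CaseHigh β i ∨ T.CaseZero β i)

end SkewTableau

/-- `comp(δ)`: remove the zeros. -/
def compOf (δ : List ℕ) : List ℕ := δ.filter (· ≠ 0)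

/-- The set `Z_β^γ` of all vectors `δ(T)` with `comp(δ(T)) = γ`, for tableaux
`T ∈ 𝔗_{(1)}^β` that satisfy the survival conditions. -/
def Zset (β γ : Comp) : Set (List ℕ) :=
  {δ | compOf δ = γ.map PNat.val ∧
    ∃ T ∈ SkewTableau.permTableaux [1] β, T.Survives β ∧ T.delta β.length = δ}

/-- The inequalities between `β` and `δ` alone among the survival conditions. -/
def NumericConditions (β : Comp) (δ : List ℕ) : Prop :=
  ∀ i, 1 ≤ i → i ≤ β.length →
    ((β.part i : ℤ) < excess β δ i → β.part i < δ.getD i 0) ∧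
    (excess β δ i < β.part i →
      δ.getD i 0 ≤ β.part i ∧ (β.part i : ℤ) - excess β δ i ≤ δ.getD i 0) ∧
    ((β.part i : ℤ) = excess β δ i → β.part i < δ.getD i 0 ∨
      (δ.getD i 0 = 0 ∧ ∀ j, i < j → j ≤ β.length → β.part j = δ.getD j 0))

/-- `sgn(v) = (-1)^k`, where `k` is the number of negative entries of `v`. -/
def sgnVec (v : List ℤ) : ℤ := (-1) ^ v.countP (· < 0)

/-- The smallest `k` with `1 ≤ k ≤ n` such that `β_j = γ_j` for all `k < j ≤ n`, `n = ℓ(β)`. -/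
noncomputable def kIndex (β γ : Comp) : ℕ :=
  sInf {k | 1 ≤ k ∧ k ≤ β.length ∧ ∀ j, k < j → j ≤ β.length → β.part j = γ.part j}

/-- The largest `r` with `k ≤ r ≤ n` such that `β_j < β_{j+1}` for all `k ≤ j < r`. -/
noncomputable def rIndex (β γ : Comp) : ℕ :=
  sSup {r | kIndex β γ ≤ r ∧ r ≤ β.length ∧
    ∀ j, kIndex β γ ≤ j → j < r → β.part j < β.part (j + 1)}

/-- The vector `(γ_1, …, γ_k, 0, γ_{k+1}, …)`. -/
def padZero (γ : Comp) (k : ℕ) : List ℕ :=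
  (γ.map PNat.val).take k ++ 0 :: (γ.map PNat.val).drop k

/-- The vector `(β_1 - γ_2, β_2 - γ_3, …, β_m - γ_{m+1})`. -/
def shiftedDiff (β γ : Comp) (m : ℕ) : List ℤ :=
  (List.range m).map fun i => (β.part (i + 1) : ℤ) - γ.part (i + 2)

open Classical in
/-- The right-hand side of the left Pieri rule. -/
noncomputable def pieriCoeff (β γ : Comp) : ℤ :=
  if γ.length = β.length + 1 ∧ γ.map PNat.val ∈ Zset β γ then
    sgnVec (shiftedDiff β γ β.length)
  else if γ.length = β.length ∧ Even (rIndex β γ - kIndex β γ) ∧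
      padZero γ (kIndex β γ) ∈ Zset β γ then
    sgnVec (shiftedDiff β γ (kIndex β γ - 1))
  else 0

/-! ### Adjoint operators and creation operators on NSym -/

namespace NSym
open Polynomial

/-! Write h_m^⊥ for the coefficients of `hPerp`, (-1)^i e_i^⊥ for those of `ePerp`, and B_a = ∑_i
(-1)^i H_{a+i} e_i^⊥ for `creation a`. Three facts carry the algebra. First, 𝔖_{(a,α)} = B_a 𝔖_α
(`immaculate_cons`), so for a > 0 the operator B_a prepends the part a to basis vectors. Second, ∑_m
B_{p+m} h_m^⊥ is left multiplication by H_p for every integer p (`sum_creation_hPerp`), since the h-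
and e-series are inverse to each other. Third, h_q^⊥ B_a = ∑_{x+y=q} B_{a-x} h_y^⊥
(`coeff_hPerp_creation`).

With p = 1 the second fact shows that the coefficient of 𝔖_{(g,γ)} in 𝔖_{(1)} 𝔖_β is the coefficient
of 𝔖_γ in h_{g-1}^⊥ 𝔖_β. This is computed by recursion on β: for β = (b,β') the third fact gives
h_q^⊥ 𝔖_β = ∑_{m≤q} B_{b-q+m} h_m^⊥ 𝔖_{β'}. If q < b, all subscripts are positive and each term
prepends a part. If q ≥ b, some are not; but the sum over all m is H_{b-q} 𝔖_{β'}, so the partial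
sum is this minus the complementary sum, whose subscripts exceed b. The minus sign is the source of
all signs. The term 𝔖_{β'}, present only for q = b, prepends no part and is recorded as a zero in δ.

Unrolled, the recursion writes a coefficient as a sum of signs over the vectors δ that satisfy the
inequalities of the theorem, with at most one zero (`NSym.perpCoeff_eq`). When ℓ(γ) = n, the
possible positions of the zero give terms that alternate on [k,r] and vanish elsewhere, which leaves
one term or none (`sum_pieriTerm_insertZero`).

For the tableaux, call i high if β_i < δ_i and low otherwise. The survival conditions force σ: it
moves a high i to i+1 and sends a low i to the one value in {1,…,i} not yet taken. They also force
block m to contain only m and the next low index after m. Balancing the contents then fixes all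
multiplicities, so δ has exactly one surviving tableau (`ExcessData.blocksSurvive_canon`,
`ExcessData.BlocksSurvive.eq_canon`), and sgn σ counts the high indices. -/

theorem H_zero : H 0 = 1 := by simp [H]

theorem H_of_neg {m : ℤ} (h : m < 0) : H m = 0 := by
  have h1 : ¬ 0 < m.toNat := by omega
  have h2 : m ≠ 0 := by omega
  simp [H, h1, h2]

theorem H_coe (a : ℕ+) : H ((a : ℕ) : ℤ) = FreeAlgebra.ι ℚ a := by
  have h : 0 < (((a : ℕ) : ℤ)).toNat := by simp
  unfold H
  rw [dif_pos h]
  congr 1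

/-- The algebra map `H_a ↦ ∑ j, H_{a-j} X ^ j`. Its coefficients are the adjoints of the
multiplications by complete homogeneous functions. -/
noncomputable def hPerp : NSym →ₐ[ℚ] NSym[X] :=
  FreeAlgebra.lift ℚ fun a : ℕ+ => ∑ j ∈ Finset.range (a + 1), C (H ((a : ℕ) - j)) * X ^ j

/-- The algebra map `H_a ↦ H_a - H_{a-1} X`. Its coefficients are up to sign the adjoints of the
multiplications by elementary functions. -/
noncomputable def ePerp : NSym →ₐ[ℚ] NSym[X] :=
  FreeAlgebra.lift ℚ fun a : ℕ+ => C (H (a : ℕ)) - C (H ((a : ℕ) - 1)) * X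

theorem coeff_hPerp_H (m : ℤ) (j : ℕ) : (hPerp (H m)).coeff j = H (m - j) := by
  rcases lt_trichotomy m 0 with h | rfl | h
  · rw [H_of_neg h, H_of_neg (by omega)]; simp
  · rw [H_zero, map_one, coeff_one]
    split_ifs with h
    · subst h; simp [H_zero]
    · rw [H_of_neg (by omega)]
  · obtain ⟨a, rfl⟩ : ∃ a : ℕ+, m = ((a : ℕ) : ℤ) :=
      ⟨⟨m.toNat, by omega⟩, by simp; omega⟩
    rw [H_coe, hPerp, FreeAlgebra.lift_ι_apply, finsetSum_coeff]
    simp only [coeff_C_mul, coeff_X_pow, mul_ite, mul_one, mul_zero]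
    rw [Finset.sum_ite_eq]
    split_ifs with h1
    · rfl
    · rw [H_of_neg]
      simp only [Finset.mem_range] at h1
      omega

theorem ePerp_H (m : ℤ) : ePerp (H m) = C (H m) - C (H (m - 1)) * X := by
  rcases lt_trichotomy m 0 with h | rfl | h
  · rw [H_of_neg h, H_of_neg (by omega)]; simp
  · rw [H_zero, map_one, H_of_neg (by omega)]; simp
  · obtain ⟨a, rfl⟩ : ∃ a : ℕ+, m = ((a : ℕ) : ℤ) :=
      ⟨⟨m.toNat, by omega⟩, by simp; omega⟩
    rw [H_coe, ePerp, FreeAlgebra.lift_ι_apply, H_coe]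

theorem coeff_ePerp_H (m : ℤ) (j : ℕ) : (ePerp (H m)).coeff j =
    if j = 0 then H m else if j = 1 then - H (m - 1) else 0 := by
  rw [ePerp_H, coeff_sub, coeff_C_mul, coeff_C, coeff_X]
  rcases j with _ | _ | j <;> simp

/-- The extension of `ePerp` to polynomials. -/
noncomputable def ePerpPoly : NSym[X] →+* NSym[X] :=
  eval₂RingHom' (ePerp : NSym →+* NSym[X]) X fun _ => (commute_X _).symm

theorem ePerpPoly_apply (p : NSym[X]) :
    ePerpPoly p = p.sum fun m c => ePerp c * X ^ m := by
  change eval₂ (ePerp : NSym →+* NSym[X]) X p = _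
  rw [eval₂_eq_sum]
  rfl

/-- This is the relation ∑ (-1)^i e_i h_{n-i} = 0 for n > 0, in adjoint form. Both sides are
multiplicative in f, so generators suffice; there the sum telescopes, and its last term vanishes
because it involves H_{-1}. -/
theorem ePerpPoly_hPerp (f : NSym) : ePerpPoly (hPerp f) = C f := by
  induction f using FreeAlgebra.induction with
  | grade0 r =>
    rw [AlgHom.commutes, Polynomial.algebraMap_apply, ePerpPoly_apply, sum_C_index (by simp),
      AlgHom.commutes, Polynomial.algebraMap_apply, pow_zero, mul_one]
  | grade1 x =>
    rw [← H_coe]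
    have h : hPerp (H ((x : ℕ) : ℤ)) =
        ∑ j ∈ Finset.range (x + 1), C (H ((x : ℕ) - j)) * X ^ j := by
      conv_lhs => rw [H_coe, hPerp, FreeAlgebra.lift_ι_apply]
    have hc : ∀ c : NSym, ePerpPoly (C c) = ePerp c := fun c => by simp [ePerpPoly_apply]
    have hX : ePerpPoly X = X := by simp [ePerpPoly_apply]
    rw [h, map_sum]
    have : ∀ j ∈ Finset.range ((x : ℕ) + 1), ePerpPoly (C (H ((x : ℕ) - j)) * X ^ j) =
        C (H ((x : ℕ) - (j : ℕ))) * X ^ j - C (H ((x : ℕ) - ((j + 1 : ℕ) : ℤ))) * X ^ (j + 1) := by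
      intro j _
      rw [map_mul, map_pow, hc, hX, ePerp_H, sub_mul, mul_assoc, ← pow_succ']
      push_cast
      rw [sub_sub]
    rw [Finset.sum_congr rfl this,
      Finset.sum_range_sub' fun j : ℕ => C (H ((x : ℕ) - (j : ℤ))) * X ^ j]
    rw [H_of_neg (m := ((x : ℕ) : ℤ) - (((x : ℕ) + 1 : ℕ) : ℤ)) (by push_cast; omega)]
    simp
  | mul a b ha hb => simp [ha, hb]
  | add a b ha hb => simp [ha, hb]

/-- The operators h_m^⊥ and e_i^⊥ commute: on generators both only lower the index of H, and on
products both obey a Leibniz rule. -/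
theorem coeff_hPerp_ePerp (f : NSym) (i m : ℕ) :
    (hPerp ((ePerp f).coeff i)).coeff m = (ePerp ((hPerp f).coeff m)).coeff i := by
  induction f using FreeAlgebra.induction generalizing i m with
  | grade0 r =>
    rw [AlgHom.commutes, AlgHom.commutes, Polynomial.algebraMap_apply, coeff_C, coeff_C]
    have key : ∀ k l : ℕ, ∀ φ : NSym →ₐ[ℚ] NSym[X],
        (φ (if k = 0 then algebraMap ℚ NSym r else 0)).coeff l =
          if k = 0 ∧ l = 0 then algebraMap ℚ NSym r else 0 := by
      intro k l φ
      by_cases hk : k = 0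
      · rw [if_pos hk, AlgHom.commutes, Polynomial.algebraMap_apply, coeff_C]
        simp only [hk, true_and]
      · rw [if_neg hk, map_zero, coeff_zero, if_neg (fun h => hk h.1)]
    rw [key, key]
    simp only [and_comm]
  | grade1 x =>
    rw [← H_coe, coeff_hPerp_H, coeff_ePerp_H, coeff_ePerp_H]
    split_ifs
    · rw [coeff_hPerp_H]
    · rw [map_neg, coeff_neg, coeff_hPerp_H, sub_right_comm]
    · simp
  | mul a b ha hb =>
    rw [map_mul, map_mul, coeff_mul, coeff_mul, map_sum, map_sum, finsetSum_coeff,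
      finsetSum_coeff]
    simp only [map_mul, coeff_mul, ha, hb]
    rw [Finset.sum_comm]
  | add a b ha hb => simp [ha, hb]

/-- The linear map `c X ^ i ↦ H_{a+i} c`. -/
noncomputable def hEval (a : ℤ) : NSym[X] →ₗ[ℚ] NSym :=
  Polynomial.lsum fun i => LinearMap.mulLeft ℚ (H (a + i))

theorem hEval_apply (a : ℤ) (p : NSym[X]) : hEval a p = p.sum fun i c => H (a + i) * c := by
  rw [hEval, lsum_apply]; rfl

theorem hEval_C (a : ℤ) (c : NSym) : hEval a (C c) = H a * c := by
  rw [hEval_apply, sum_C_index] <;> simp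

theorem hEval_mul_X_pow (a : ℤ) (p : NSym[X]) (m : ℕ) :
    hEval a (p * X ^ m) = hEval (a + m) p := by
  induction p using Polynomial.induction_on' with
  | add p q hp hq => rw [add_mul, map_add, map_add, hp, hq]
  | monomial n c =>
    rw [monomial_mul_X_pow, hEval_apply, hEval_apply, sum_monomial_index, sum_monomial_index]
    · congr 2; push_cast; ring
    · simp
    · simp

/-- The creation operators. -/
noncomputable def creation (a : ℤ) : NSym →ₗ[ℚ] NSym := hEval a ∘ₗ ePerp.toLinearMap

theorem creation_apply (a : ℤ) (f : NSym) : creation a f = hEval a (ePerp f) := rfl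

/-- A factor X^m raises the subscript of H by m, so the sum is `hEval p` of the e-series applied to
the h-series of f. That composite is the constant f. -/
theorem sum_creation_hPerp (p : ℤ) (f : NSym) {N : ℕ} (hN : (hPerp f).natDegree < N) :
    ∑ m ∈ Finset.range N, creation (p + m) ((hPerp f).coeff m) = H p * f := by
  rw [← hEval_C, ← ePerpPoly_hPerp f, ePerpPoly_apply, sum_over_range' _ (by simp) N hN, map_sum]
  simp only [hEval_mul_X_pow, creation_apply]

/-- Apply the Leibniz rule for h_q^⊥ to each H_{a+i} · e_i^⊥ f: the first factor becomes H_{a-x+i},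
and in the second h_y^⊥ commutes past e_i^⊥. -/
theorem coeff_hPerp_creation (a : ℤ) (f : NSym) (q : ℕ) :
    (hPerp (creation a f)).coeff q =
      ∑ x ∈ Finset.HasAntidiagonal.antidiagonal q, creation (a - x.1) ((hPerp f).coeff x.2) := by
  -- A common degree bound puts all the sums over i on one finite range, so that they can be
  -- interchanged.
  obtain ⟨N, hN1, hN2⟩ : ∃ N, (ePerp f).natDegree < N ∧
      ∀ m ≤ q, (ePerp ((hPerp f).coeff m)).natDegree < N := by
    refine ⟨(ePerp f).natDegree + 1 + ∑ m ∈ Finset.range (q + 1),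
      (ePerp ((hPerp f).coeff m)).natDegree, by omega, fun m hm => ?_⟩
    have := Finset.single_le_sum (f := fun m => (ePerp ((hPerp f).coeff m)).natDegree)
      (fun _ _ => Nat.zero_le _) (Finset.mem_range.2 (Nat.lt_add_one_of_le hm))
    omega
  have h2 : ∀ x ∈ Finset.HasAntidiagonal.antidiagonal q, creation (a - x.1) ((hPerp f).coeff x.2) =
      ∑ i ∈ Finset.range N, H (a - x.1 + i) * (hPerp ((ePerp f).coeff i)).coeff x.2 := by
    intro x hx
    have hx' : x.2 ≤ q := by have := Finset.HasAntidiagonal.mem_antidiagonal.1 hx; omega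
    rw [creation_apply, hEval_apply, sum_over_range' _ (by simp) N (hN2 _ hx')]
    exact Finset.sum_congr rfl fun i _ => by rw [coeff_hPerp_ePerp]
  rw [Finset.sum_congr rfl h2, creation_apply, hEval_apply,
    sum_over_range' _ (by simp) N hN1, map_sum, finsetSum_coeff, Finset.sum_comm]
  refine Finset.sum_congr rfl fun i _ => ?_
  rw [map_mul, coeff_mul]
  refine Finset.sum_congr rfl fun x _ => ?_
  rw [coeff_hPerp_H]
  congr 2
  ring

/-! ### Immaculate functions through Vandermonde determinants -/

/-- The linear functional `X ^ e ↦ H_{c_1 + e_1} ⋯ H_{c_k + e_k}`. -/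
noncomputable def hFun {k : ℕ} (c : Fin k → ℤ) : MvPolynomial (Fin k) ℚ →ₗ[ℚ] NSym :=
  (MvPolynomial.basisMonomials (Fin k) ℚ).constr ℚ
    fun e => (List.ofFn fun i => H (c i + e i)).prod

theorem hFun_monomial {k : ℕ} (c : Fin k → ℤ) (e : Fin k →₀ ℕ) :
    hFun c (MvPolynomial.monomial e 1) = (List.ofFn fun i => H (c i + e i)).prod := by
  have := (MvPolynomial.basisMonomials (Fin k) ℚ).constr_basis ℚ
    (fun e => (List.ofFn fun i => H (c i + e i)).prod) e
  rwa [MvPolynomial.coe_basisMonomials] at this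

theorem mvPolynomial_linearMap_ext {k : ℕ} {M : Type*} [AddCommMonoid M] [Module ℚ M]
    {f g : MvPolynomial (Fin k) ℚ →ₗ[ℚ] M}
    (h : ∀ e, f (MvPolynomial.monomial e 1) = g (MvPolynomial.monomial e 1)) : f = g :=
  (MvPolynomial.basisMonomials (Fin k) ℚ).ext fun e => by
    simpa [MvPolynomial.coe_basisMonomials] using h e

/-- Variables index the factors of a noncommutative product, so the variable x_0 only affects the
leftmost factor. -/
theorem hFun_succ {k : ℕ} (c : Fin (k + 1) → ℤ) (m : ℕ) (q : MvPolynomial (Fin k) ℚ) :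
    hFun c (MvPolynomial.rename Fin.succ q * MvPolynomial.X 0 ^ m) =
      H (c 0 + m) * hFun (Fin.tail c) q := by
  have : hFun c ∘ₗ LinearMap.mulRight ℚ (MvPolynomial.X 0 ^ m) ∘ₗ
      (MvPolynomial.rename Fin.succ).toLinearMap =
      LinearMap.mulLeft ℚ (H (c 0 + m)) ∘ₗ hFun (Fin.tail c) := by
    refine mvPolynomial_linearMap_ext fun e => ?_
    simp only [LinearMap.comp_apply, LinearMap.mulRight_apply, LinearMap.mulLeft_apply,
      AlgHom.toLinearMap_apply, MvPolynomial.rename_monomial]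
    rw [MvPolynomial.X_pow_eq_monomial, MvPolynomial.monomial_mul, one_mul, hFun_monomial,
      hFun_monomial, List.ofFn_succ, List.prod_cons]
    congr 2
    · congr 2
      rw [Finsupp.add_apply, Finsupp.mapDomain_of_notMem_range]
      · simp
      · rintro ⟨x, hx⟩; exact Fin.succ_ne_zero x hx
    · congr 1
      funext i
      rw [Finsupp.add_apply, Finsupp.mapDomain_apply (Fin.succ_injective k),
        Finsupp.single_eq_of_ne (Fin.succ_ne_zero i)]
      rfl
  exact LinearMap.congr_fun this q

/-- The linear functional `hFun`, applied to the coefficients of a polynomial. -/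
noncomputable def hFunPoly {k : ℕ} (c : Fin k → ℤ) :
    (MvPolynomial (Fin k) ℚ)[X] →ₗ[ℚ] NSym[X] :=
  Polynomial.lsum fun i => (Polynomial.monomial i).restrictScalars ℚ ∘ₗ hFun c

theorem hFunPoly_monomial {k : ℕ} (c : Fin k → ℤ) (i : ℕ) (q : MvPolynomial (Fin k) ℚ) :
    hFunPoly c (Polynomial.monomial i q) = Polynomial.monomial i (hFun c q) := by
  rw [hFunPoly, lsum_apply, sum_monomial_index] <;> simp

theorem hFunPoly_X_mul {k : ℕ} (c : Fin k → ℤ) (p : (MvPolynomial (Fin k) ℚ)[X]) :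
    hFunPoly c (X * p) = X * hFunPoly c p := by
  induction p using Polynomial.induction_on' with
  | add p q hp hq => rw [mul_add, map_add, map_add, hp, hq, mul_add]
  | monomial n q => rw [X_mul_monomial, hFunPoly_monomial, hFunPoly_monomial, X_mul_monomial]

theorem hFunPoly_succ {k : ℕ} (c : Fin (k + 1) → ℤ) (m : ℕ) (p : (MvPolynomial (Fin k) ℚ)[X]) :
    hFunPoly c (Polynomial.map (MvPolynomial.rename Fin.succ).toRingHom p *
      C (MvPolynomial.X 0 ^ m)) = C (H (c 0 + m)) * hFunPoly (Fin.tail c) p := by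
  induction p using Polynomial.induction_on' with
  | add p q hp hq => rw [Polynomial.map_add, add_mul, map_add, map_add, hp, hq, mul_add]
  | monomial n q =>
    rw [Polynomial.map_monomial, monomial_mul_C, hFunPoly_monomial, hFunPoly_monomial,
      C_mul_monomial]
    congr 1
    exact hFun_succ c m q

/-- Substituting x_0 for X turns X^n into the left factor H_{c_0+n}, which is what `hEval` does. -/
theorem hFun_eval₂ {k : ℕ} (c : Fin (k + 1) → ℤ) (p : (MvPolynomial (Fin k) ℚ)[X]) :
    hFun c (Polynomial.eval₂ (MvPolynomial.rename Fin.succ).toRingHom (MvPolynomial.X 0) p) =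
      hEval (c 0) (hFunPoly (Fin.tail c) p) := by
  induction p using Polynomial.induction_on' with
  | add p q hp hq => rw [Polynomial.eval₂_add, map_add, map_add, hp, hq, map_add]
  | monomial n q =>
    rw [Polynomial.eval₂_monomial, hFunPoly_monomial, hEval_apply, sum_monomial_index _ _ (by simp)]
    exact hFun_succ c n q

/-- `∏ j, (x_j - X)`. -/
noncomputable def rootProd (k : ℕ) : (MvPolynomial (Fin k) ℚ)[X] :=
  ∏ j : Fin k, (C (MvPolynomial.X j) - X)

/-- On one factor, H_m - H_{m-1} X is the functional with constant lowered by 1, applied to x^e (x -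
X). Multiplying over all factors produces `rootProd`; lowering all constants keeps the powers
nonnegative. -/
theorem ePerp_hFun_monomial {k : ℕ} (c : Fin k → ℤ) (e : Fin k →₀ ℕ) :
    ePerp (hFun c (MvPolynomial.monomial e 1)) =
      hFunPoly (fun i => c i - 1) (rootProd k * C (MvPolynomial.monomial e 1)) := by
  induction k with
  | zero =>
    rw [rootProd, Finset.univ_eq_empty, Finset.prod_empty, one_mul, ← monomial_zero_left,
      hFunPoly_monomial, hFun_monomial, hFun_monomial]
    simp
  | succ k ih =>
    set e' : Fin k →₀ ℕ := Finsupp.tail e with he'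
    have hsplit : (MvPolynomial.monomial e 1 : MvPolynomial (Fin (k + 1)) ℚ) =
        MvPolynomial.rename Fin.succ (MvPolynomial.monomial e' 1) * MvPolynomial.X 0 ^ e 0 := by
      have he : Finsupp.mapDomain Fin.succ e' + Finsupp.single 0 (e 0) = e := by
        refine Finsupp.ext fun i => ?_
        refine Fin.cases ?_ (fun i => ?_) i
        · rw [Finsupp.add_apply, Finsupp.mapDomain_of_notMem_range]
          · simp
          · rintro ⟨x, hx⟩; exact Fin.succ_ne_zero x hx
        · rw [Finsupp.add_apply, Finsupp.mapDomain_apply (Fin.succ_injective k),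
            Finsupp.single_eq_of_ne (Fin.succ_ne_zero i)]
          rfl
      rw [MvPolynomial.rename_monomial, MvPolynomial.X_pow_eq_monomial, MvPolynomial.monomial_mul,
        one_mul, he]
    set p := rootProd k * C (MvPolynomial.monomial e' 1) with hp
    -- Splits off the factor x_0 - X, whose two terms match the two terms of `ePerp` on the leftmost
    -- H.
    have hmap : rootProd (k + 1) * C (MvPolynomial.monomial e 1) =
        Polynomial.map (MvPolynomial.rename Fin.succ).toRingHom p * C (MvPolynomial.X 0 ^ (e 0 + 1))
        - X * (Polynomial.map (MvPolynomial.rename Fin.succ).toRingHom p *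
          C (MvPolynomial.X 0 ^ e 0)) := by
      have h1 : Polynomial.map (MvPolynomial.rename Fin.succ).toRingHom p =
          (∏ j : Fin k, (C (MvPolynomial.X j.succ) - X)) *
            C (MvPolynomial.rename Fin.succ (MvPolynomial.monomial e' (1 : ℚ))) := by
        rw [hp, rootProd, Polynomial.map_mul, Polynomial.map_prod, Polynomial.map_C]
        congr 1
        refine Finset.prod_congr rfl fun j _ => ?_
        rw [Polynomial.map_sub, Polynomial.map_C, Polynomial.map_X]
        congr 2
        exact MvPolynomial.rename_X _ _
      rw [h1, hsplit, rootProd, Fin.prod_univ_succ, C_mul, pow_succ, C_mul]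
      ring
    rw [hmap, map_sub, hFunPoly_X_mul, hFunPoly_succ, hFunPoly_succ]
    have ih' := ih (Fin.tail c) e'
    have h3 : (Fin.tail fun i => c i - 1) = fun i => Fin.tail c i - 1 := rfl
    rw [h3, ← ih', hsplit, hFun_succ, map_mul, ePerp_H, sub_mul]
    congr 1
    · congr 3
      push_cast; ring
    · rw [← X_mul_C, mul_assoc, add_sub_right_comm]

theorem ePerp_hFun {k : ℕ} (c : Fin k → ℤ) (q : MvPolynomial (Fin k) ℚ) :
    ePerp (hFun c q) = hFunPoly (fun i => c i - 1) (rootProd k * C q) := by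
  induction q using MvPolynomial.induction_on' with
  | monomial e r =>
    have h : MvPolynomial.monomial e r = r • MvPolynomial.monomial e (1 : ℚ) := by
      rw [MvPolynomial.smul_monomial, smul_eq_mul, mul_one]
    rw [h, map_smul, map_smul, ePerp_hFun_monomial, ← smul_C, mul_smul_comm, map_smul]
  | add p q hp hq => rw [map_add, map_add, hp, hq, C_add, mul_add, map_add]

/-- The Vandermonde product. -/
noncomputable def vand (k : ℕ) : MvPolynomial (Fin k) ℚ :=
  (Matrix.vandermonde fun i : Fin k => (MvPolynomial.X i : MvPolynomial (Fin k) ℚ)).det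

/-- In ∏_{i<j} (x_j - x_i) the factors with i = 0 are `rootProd` at X = x_0; the others form the
Vandermonde product of the remaining variables. -/
theorem vand_succ (k : ℕ) : vand (k + 1) =
    Polynomial.eval₂ (MvPolynomial.rename Fin.succ).toRingHom (MvPolynomial.X 0)
      (rootProd k * C (vand k)) := by
  have h1 : (MvPolynomial.rename Fin.succ).toRingHom (vand k) =
      (Matrix.vandermonde fun i : Fin k =>
        (MvPolynomial.X i.succ : MvPolynomial (Fin (k + 1)) ℚ)).det := by
    rw [vand, RingHom.map_det]
    congr 1
    ext i j : 2
    simp [Matrix.vandermonde]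
  rw [Polynomial.eval₂_mul, Polynomial.eval₂_C, h1, rootProd, Polynomial.eval₂_finsetProd, vand,
    Matrix.det_vandermonde, Matrix.det_vandermonde, Fin.prod_univ_succ]
  congr 1
  · rw [Fin.prod_Ioi_zero]
    refine Finset.prod_congr rfl fun j _ => ?_
    simp
  · refine Finset.prod_congr rfl fun j _ => ?_
    rw [Fin.prod_Ioi_succ]

/-- The term of σ in the transposed Vandermonde determinant has exponent σ_i at x_i, so a
commutative determinant encodes the Jacobi–Trudi-like sum in the noncommutative algebra. -/
theorem immaculate_eq_hFun (α : Comp) :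
    immaculate α = hFun (fun i : Fin α.length => (α.get i : ℤ) - i) (vand α.length) := by
  rw [vand, ← Matrix.det_transpose, Matrix.det_apply, map_sum, immaculate]
  refine Finset.sum_congr rfl fun σ _ => ?_
  rw [Units.smul_def, map_zsmul]
  congr 1
  have : (∏ i, (Matrix.vandermonde fun i : Fin α.length =>
      (MvPolynomial.X i : MvPolynomial (Fin α.length) ℚ)).transpose (σ i) i) =
      MvPolynomial.monomial (Finsupp.equivFunOnFinite.symm fun i => (σ i : ℕ)) 1 := by
    rw [MvPolynomial.monomial_eq, Finsupp.prod_fintype _ _ (by simp)]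
    simp [Matrix.vandermonde]
  rw [this, hFun_monomial]
  congr 2
  funext i
  congr 1
  simp
  ring

/-- The shift by 1 in the remaining constants cancels the lowering by 1 in `ePerp_hFun`. -/
theorem hFun_vand_succ {k : ℕ} (c : Fin (k + 1) → ℤ) :
    hFun c (vand (k + 1)) = creation (c 0) (hFun (fun i => c i.succ + 1) (vand k)) := by
  rw [vand_succ, hFun_eval₂, creation_apply, ePerp_hFun]
  simp only [add_sub_cancel_right]
  rfl

theorem immaculate_cons (a : ℕ+) (α : Comp) :
    immaculate (a :: α) = creation (a : ℕ) (immaculate α) := by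
  rw [immaculate_eq_hFun, immaculate_eq_hFun]
  refine (hFun_vand_succ (k := α.length) fun i => ((a :: α : List ℕ+).get i : ℤ) - i).trans ?_
  have h0 : (((a :: α : List ℕ+).get (0 : Fin (α.length + 1)) : ℕ) : ℤ) -
      ((0 : Fin (α.length + 1)) : ℕ) = ((a : ℕ) : ℤ) := by simp
  have h1 : (fun i : Fin α.length => (((a :: α : List ℕ+).get i.succ : ℕ) : ℤ) -
      (i.succ : ℕ) + 1) = fun i : Fin α.length => (α.get i : ℤ) - i := by
    funext i
    simp only [List.get_eq_getElem, Fin.val_succ, List.getElem_cons_succ]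
    push_cast
    ring
  exact congrArg₂ (fun x y => creation x (hFun y (vand α.length))) h0 h1

theorem immaculate_nil : immaculate [] = 1 := by
  simp [immaculate]

end NSym

/-! ### Recursion for the structure constants -/

namespace NSym
open Polynomial

theorem immaculateBasis_apply (α : Comp) : immaculateBasis α = immaculate α := by
  rw [immaculateBasis, Module.Basis.mk_apply]

theorem repr_immaculate_self (α : Comp) :
    immaculateBasis.repr (immaculate α) = Finsupp.single α 1 := by
  rw [← immaculateBasis_apply, Module.Basis.repr_self]

/-- It suffices to take f in the immaculate basis, where the operator prepends d. -/
theorem repr_creation_cons (d g : ℕ+) (γ : Comp) (f : NSym) :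
    immaculateBasis.repr (creation (d : ℕ) f) (g :: γ) =
      if g = d then immaculateBasis.repr f γ else 0 := by
  classical
  suffices h : Finsupp.lapply (g :: γ) ∘ₗ immaculateBasis.repr.toLinearMap ∘ₗ creation (d : ℕ) =
      (if g = d then (1 : ℚ) else 0) • (Finsupp.lapply γ ∘ₗ immaculateBasis.repr.toLinearMap) by
    have := LinearMap.congr_fun h f
    by_cases hgd : g = d <;> simpa [hgd] using this
  refine immaculateBasis.ext fun α => ?_
  simp only [LinearMap.comp_apply, LinearMap.smul_apply, LinearEquiv.coe_coe,
    immaculateBasis_apply, ← immaculate_cons, repr_immaculate_self, Finsupp.lapply_apply,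
    Finsupp.single_apply, List.cons.injEq, smul_eq_mul]
  split_ifs <;> simp_all

theorem repr_creation_nil (d : ℕ+) (f : NSym) :
    immaculateBasis.repr (creation (d : ℕ) f) [] = 0 := by
  classical
  suffices h : Finsupp.lapply [] ∘ₗ immaculateBasis.repr.toLinearMap ∘ₗ creation (d : ℕ) = 0 by
    have := LinearMap.congr_fun h f
    simpa using this
  refine immaculateBasis.ext fun α => ?_
  simp [immaculateBasis_apply, ← immaculate_cons, repr_immaculate_self]

/-- The coefficient of `𝔖_γ` in the `q`-th coefficient of `hPerp 𝔖_β`. -/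
noncomputable def perpCoeff (q : ℕ) (β γ : Comp) : ℚ :=
  immaculateBasis.repr ((hPerp (immaculate β)).coeff q) γ

theorem coeff_hPerp_creation_range (a : ℤ) (f : NSym) (q : ℕ) :
    (hPerp (creation a f)).coeff q =
      ∑ m ∈ Finset.range (q + 1), creation (a - q + m) ((hPerp f).coeff m) := by
  rw [coeff_hPerp_creation, ← Finset.Nat.sum_antidiagonal_swap,
    Finset.Nat.sum_antidiagonal_eq_sum_range_succ_mk]
  refine Finset.sum_congr rfl fun m hm => ?_
  have := Finset.mem_range.1 hm
  simp only [Prod.fst_swap, Prod.snd_swap]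
  congr 2
  omega

/-- Only the m with p + m = g contributes, provided that it is a natural number lying in s. -/
theorem repr_sum_creation_cons {f : NSym} {p : ℤ} {s : Finset ℕ}
    (hs : ∀ m ∈ s, 0 < p + m) (g : ℕ+) (γ : Comp) :
    immaculateBasis.repr (∑ m ∈ s, creation (p + m) ((hPerp f).coeff m)) (g :: γ) =
      if 0 ≤ (g : ℕ) - p ∧ ((g : ℕ) - p).toNat ∈ s then
        immaculateBasis.repr ((hPerp f).coeff ((g : ℕ) - p).toNat) γ else 0 := by
  have h : ∀ m ∈ s, immaculateBasis.repr (creation (p + m) ((hPerp f).coeff m)) (g :: γ) =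
      if ((g : ℕ) : ℤ) = p + m then immaculateBasis.repr ((hPerp f).coeff m) γ else 0 := by
    intro m hm
    obtain ⟨d, hd⟩ : ∃ d : ℕ+, p + m = ((d : ℕ) : ℤ) :=
      ⟨⟨(p + m).toNat, by have := hs m hm; omega⟩, by have := hs m hm; simp; omega⟩
    rw [hd, repr_creation_cons]
    congr 1
    simp
  rw [map_sum, Finsupp.finsetSum_apply, Finset.sum_congr rfl h]
  split_ifs with h1
  · rw [Finset.sum_eq_single_of_mem _ h1.2]
    · rw [if_pos (by omega)]
    · intro m _ hne
      rw [if_neg (by omega)]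
  · refine Finset.sum_eq_zero fun m hm => ?_
    rw [if_neg]
    intro h2
    refine h1 ⟨by omega, ?_⟩
    have : ((g : ℕ) - p).toNat = m := by omega
    rwa [this]

theorem repr_sum_creation_nil {f : NSym} {p : ℤ} {s : Finset ℕ} (hs : ∀ m ∈ s, 0 < p + m) :
    immaculateBasis.repr (∑ m ∈ s, creation (p + m) ((hPerp f).coeff m)) [] = 0 := by
  rw [map_sum, Finsupp.finsetSum_apply]
  refine Finset.sum_eq_zero fun m hm => ?_
  obtain ⟨d, hd⟩ : ∃ d : ℕ+, p + m = ((d : ℕ) : ℤ) :=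
    ⟨⟨(p + m).toNat, by have := hs m hm; omega⟩, by have := hs m hm; simp; omega⟩
  rw [hd, repr_creation_nil]

theorem perpCoeff_nil (q : ℕ) (γ : Comp) :
    perpCoeff q [] γ = if q = 0 ∧ γ = [] then 1 else 0 := by
  classical
  rw [perpCoeff, immaculate_nil, map_one, coeff_one]
  by_cases h : q = 0
  · rw [if_pos h, ← immaculate_nil, repr_immaculate_self, Finsupp.single_apply]
    simp only [h, true_and, eq_comm]
  · simp [h]

theorem perpCoeff_of_lt {q : ℕ} {b : ℕ+} (h : q < b) (β : Comp) (g : ℕ+) (γ : Comp) :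
    perpCoeff q (b :: β) (g :: γ) =
      if (g : ℕ) ≤ b ∧ b ≤ q + (g : ℕ) then perpCoeff (q + g - b) β γ else 0 := by
  rw [perpCoeff, immaculate_cons, coeff_hPerp_creation_range, repr_sum_creation_cons (by omega)]
  have h1 : (((g : ℕ) : ℤ) - ((b : ℕ) - q)).toNat = q + g - b := by omega
  rw [h1, perpCoeff]
  congr 1
  simp only [Finset.mem_range, eq_iff_iff]
  omega

theorem perpCoeff_of_lt_nil {q : ℕ} {b : ℕ+} (h : q < b) (β : Comp) :
    perpCoeff q (b :: β) [] = 0 := by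
  rw [perpCoeff, immaculate_cons, coeff_hPerp_creation_range, repr_sum_creation_nil (by omega)]

/-- Here the subscripts b - q + m with m ≤ q need not be positive. The full sum over m is H_{b-q}
𝔖_β, with H_{b-q} equal to 1 or 0, so the partial sum may be traded for the complementary one, whose
subscripts are positive. -/
theorem coeff_hPerp_immaculate_of_le {q : ℕ} {b : ℕ+} (h : b ≤ q) (β : Comp) {N : ℕ}
    (hN : (hPerp (immaculate β)).natDegree < N) (hq : q < N) :
    (hPerp (immaculate (b :: β))).coeff q = (if (b : ℕ) = q then immaculate β else 0) -
      ∑ m ∈ Finset.Ico (q + 1) N,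
        creation (((b : ℕ) : ℤ) - q + m) ((hPerp (immaculate β)).coeff m) := by
  rw [immaculate_cons, coeff_hPerp_creation_range, eq_sub_iff_add_eq,
    Finset.sum_range_add_sum_Ico _ (by omega), sum_creation_hPerp _ _ hN]
  split_ifs with h1
  · rw [h1, sub_self, H_zero, one_mul]
  · rw [H_of_neg (by omega), zero_mul]

theorem perpCoeff_of_le {q : ℕ} {b : ℕ+} (h : b ≤ q) (β : Comp) (g : ℕ+) (γ : Comp) :
    perpCoeff q (b :: β) (g :: γ) = (if (b : ℕ) = q ∧ β = g :: γ then 1 else 0) -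
      if b < g then perpCoeff (q + g - b) β γ else 0 := by
  classical
  rw [perpCoeff, coeff_hPerp_immaculate_of_le h β
    -- The summands q and g make the range contain the index q + g - b that produces the part g.
    (N := (hPerp (immaculate β)).natDegree + 1 + q + g) (by omega) (by omega), map_sub,
    Finsupp.sub_apply, repr_sum_creation_cons (by simp only [Finset.mem_Ico]; omega)]
  have h1 : (((g : ℕ) : ℤ) - ((b : ℕ) - q)).toNat = q + g - b := by omega
  rw [h1, perpCoeff]
  congr 1
  · by_cases h2 : (b : ℕ) = q
    · rw [if_pos h2, repr_immaculate_self, Finsupp.single_apply]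
      simp only [h2, true_and]
    · simp [h2]
  · have hb := b.pos
    congr 1
    rw [← PNat.coe_lt_coe]
    simp only [Finset.mem_Ico, eq_iff_iff]
    omega

theorem perpCoeff_of_le_nil {q : ℕ} {b : ℕ+} (h : b ≤ q) (β : Comp) :
    perpCoeff q (b :: β) [] = if (b : ℕ) = q ∧ β = [] then 1 else 0 := by
  classical
  rw [perpCoeff, coeff_hPerp_immaculate_of_le h β
    (N := (hPerp (immaculate β)).natDegree + 1 + q) (by omega) (by omega), map_sub,
    Finsupp.sub_apply, repr_sum_creation_nil (by simp only [Finset.mem_Ico]; omega), sub_zero]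
  by_cases h2 : (b : ℕ) = q
  · rw [if_pos h2, repr_immaculate_self, Finsupp.single_apply]
    simp only [h2, true_and]
  · simp [h2]

theorem immaculate_one : immaculate [1] = H 1 := by
  simp [immaculate]

theorem immaculate_one_mul (β : Comp) {N : ℕ} (hN : (hPerp (immaculate β)).natDegree < N) :
    immaculate [1] * immaculate β =
      ∑ m ∈ Finset.range N, creation (1 + m) ((hPerp (immaculate β)).coeff m) := by
  rw [immaculate_one, sum_creation_hPerp _ _ hN]

theorem structureConst_one_nil (β : Comp) : structureConst [1] β [] = 0 := by
  rw [structureConst, immaculate_one_mul β (Nat.lt_succ_self _),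
    repr_sum_creation_nil (fun m _ => by omega)]

theorem structureConst_one_cons (β : Comp) (g : ℕ+) (γ : Comp) :
    structureConst [1] β (g :: γ) = perpCoeff (g - 1) β γ := by
  have hg := g.pos
  rw [structureConst,
    immaculate_one_mul β (N := (hPerp (immaculate β)).natDegree + 1 + g) (by omega),
    repr_sum_creation_cons (fun m _ => by omega), if_pos, perpCoeff]
  · congr 3; omega
  · simp only [Finset.mem_range]; omega

end NSym

/-! ### The recursion as a sum over vectors -/

/-- The conditions on the parts of `δ` below the first one, with initial excess `q`. -/
def PieriVec : ℕ → Comp → List ℕ → Prop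
  | q, [], [] => q = 0
  | q, b :: β, d :: δ => ((b : ℕ) < q → (b : ℕ) < d) ∧ (q < b → d ≤ b ∧ (b : ℕ) ≤ q + d) ∧
      ((b : ℕ) = q → (b : ℕ) < d ∨ (d = 0 ∧ δ = β.map PNat.val)) ∧ PieriVec (q + d - b) β δ
  | _, _, _ => False

/-- The sign `(-1) ^ #{i | β_i < δ_i}`. -/
def diffSign : Comp → List ℕ → ℤ
  | b :: β, d :: δ => (if (b : ℕ) < d then -1 else 1) * diffSign β δ
  | _, _ => 1

open Classical in
/-- The contribution of `δ` to the Pieri coefficients. -/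
noncomputable def pieriTerm (q : ℕ) (β : Comp) (δ : List ℕ) : ℤ :=
  if PieriVec q β δ then diffSign β δ else 0

/-- Once the excess is 0 it stays 0 along δ = β. Hence a zero that uses up the excess can be
completed by copying the rest of β. -/
theorem pieriVec_self (β : Comp) : PieriVec 0 β (β.map PNat.val) := by
  induction β with
  | nil => rfl
  | cons b β ih =>
    have := b.pos
    refine ⟨by omega, by omega, by omega, ?_⟩
    rw [zero_add, Nat.sub_self]
    exact ih

theorem diffSign_self (β : Comp) : diffSign β (β.map PNat.val) = 1 := by
  induction β with
  | nil => rfl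
  | cons b β ih => simp [diffSign, ih]

theorem PieriVec.length_eq {q : ℕ} {β : Comp} {δ : List ℕ} (h : PieriVec q β δ) :
    δ.length = β.length := by
  induction β generalizing q δ with
  | nil => cases δ with
    | nil => rfl
    | cons d δ => exact h.elim
  | cons b β ih => cases δ with
    | nil => exact h.elim
    | cons d δ => simp [ih h.2.2.2]

theorem PieriVec.sum_eq {q : ℕ} {β : Comp} {δ : List ℕ} (h : PieriVec q β δ) :
    q + δ.sum = β.size := by
  induction β generalizing q δ with
  | nil => cases δ with
    | nil =>
      have h : q = 0 := h
      simpa [Comp.size] using h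
    | cons d δ => exact h.elim
  | cons b β ih => cases δ with
    | nil => exact h.elim
    | cons d δ =>
      obtain ⟨h1, h2, h3, h4⟩ := h
      have := ih h4
      simp only [Comp.size, List.map_cons, List.sum_cons] at this ⊢
      have hb : PNat.val b = (b : ℕ) := rfl
      omega

theorem pieriTerm_nil (q : ℕ) (δ : List ℕ) :
    pieriTerm q [] δ = if q = 0 ∧ δ = [] then 1 else 0 := by
  cases δ <;> by_cases h : q = 0 <;> simp [pieriTerm, PieriVec, diffSign, h]

theorem pieriTerm_cons_nil (q : ℕ) (b : ℕ+) (β : Comp) : pieriTerm q (b :: β) [] = 0 := by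
  simp [pieriTerm, PieriVec]

theorem pieriTerm_of_lt {q : ℕ} {b : ℕ+} (h : q < b) (β : Comp) (d : ℕ) (δ : List ℕ) :
    pieriTerm q (b :: β) (d :: δ) =
      if d ≤ b ∧ b ≤ q + d then pieriTerm (q + d - b) β δ else 0 := by
  unfold pieriTerm
  rw [PieriVec, diffSign]
  by_cases h1 : d ≤ b ∧ b ≤ q + d
  · rw [if_pos h1, if_neg (show ¬ (b : ℕ) < d by omega), one_mul]
    congr 1
    rw [eq_iff_iff]
    exact ⟨fun h => h.2.2.2, fun h2 => ⟨by omega, fun _ => h1, by omega, h2⟩⟩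
  · rw [if_neg h1, if_neg fun h2 => h1 (h2.2.1 h)]

theorem pieriTerm_of_le {q : ℕ} {b : ℕ+} (h : b ≤ q) (β : Comp) {d : ℕ} (hd : 0 < d)
    (δ : List ℕ) : pieriTerm q (b :: β) (d :: δ) =
      if b < d then - pieriTerm (q + d - b) β δ else 0 := by
  unfold pieriTerm
  rw [PieriVec, diffSign]
  by_cases h1 : (b : ℕ) < d
  · rw [if_pos h1, if_pos h1, neg_one_mul, ← neg_zero, ← apply_ite Neg.neg, neg_zero]
    congr 2
    rw [eq_iff_iff]
    exact ⟨fun h => h.2.2.2, fun h2 => ⟨fun _ => h1, by omega, fun _ => Or.inl h1, h2⟩⟩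
  · simp only [if_neg h1]
    rw [if_neg]
    rintro ⟨h2, h3, h4, -⟩
    omega

/-- The strict inequalities exclude d = 0 for b < q and for q < b; what is left is the exceptional
case b = q. -/
theorem pieriTerm_zero_cons (q : ℕ) (b : ℕ+) (β : Comp) (δ : List ℕ) :
    pieriTerm q (b :: β) (0 :: δ) = if (b : ℕ) = q ∧ δ = β.map PNat.val then 1 else 0 := by
  have hb := b.pos
  unfold pieriTerm
  rw [PieriVec, diffSign, if_neg (show ¬ (b : ℕ) < 0 by omega), one_mul]
  by_cases h : (b : ℕ) = q ∧ δ = β.map PNat.val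
  · obtain ⟨h1, rfl⟩ := h
    rw [if_pos, diffSign_self, if_pos ⟨h1, rfl⟩]
    refine ⟨by omega, by omega, fun _ => Or.inr ⟨rfl, rfl⟩, ?_⟩
    rw [h1, add_zero, Nat.sub_self]
    exact pieriVec_self β
  · rw [if_neg h, if_neg]
    rintro ⟨h2, h3, h4, -⟩
    apply h
    have hq : (b : ℕ) = q := by omega
    refine ⟨hq, ?_⟩
    exact ((h4 hq).resolve_left (by omega)).2

/-- Insert a zero after the first `i` entries. -/
def insertZero (γ : List ℕ) (i : ℕ) : List ℕ := γ.take i ++ 0 :: γ.drop i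

theorem insertZero_zero (γ : List ℕ) : insertZero γ 0 = 0 :: γ := rfl

theorem insertZero_cons_succ (g : ℕ) (γ : List ℕ) (i : ℕ) :
    insertZero (g :: γ) (i + 1) = g :: insertZero γ i := rfl

theorem insertZero_nil (i : ℕ) : insertZero [] i = [0] := by simp [insertZero]

/-- `pieriTerm` obeys the same recursion as `perpCoeff`. The zero inserted in front accounts for the
exceptional basis vector at q = b; zeros further back are handled by induction. -/
theorem NSym.perpCoeff_eq (q : ℕ) (β γ : Comp) :
    NSym.perpCoeff q β γ = ((pieriTerm q β (γ.map PNat.val) +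
      ∑ i ∈ Finset.range β.length, pieriTerm q β (insertZero (γ.map PNat.val) i) : ℤ) : ℚ) := by
  induction β generalizing q γ with
  | nil =>
    rw [NSym.perpCoeff_nil, pieriTerm_nil]
    simp
  | cons b β ih =>
    rw [List.length_cons, Finset.sum_range_succ']
    cases γ with
    | nil =>
      have h0 : ∑ i ∈ Finset.range β.length,
          pieriTerm q (b :: β) (insertZero (([] : Comp).map PNat.val) (i + 1)) = 0 := by
        refine Finset.sum_eq_zero fun i hi => ?_
        rw [List.map_nil, insertZero_nil, pieriTerm_zero_cons, if_neg]
        rintro ⟨-, h⟩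
        have := congrArg List.length h
        simp only [List.length_nil, List.length_map] at this
        simp [← this] at hi
      rw [h0, List.map_nil, pieriTerm_cons_nil, insertZero_nil, pieriTerm_zero_cons]
      rcases lt_or_ge q b with h | h
      · rw [NSym.perpCoeff_of_lt_nil h, if_neg (by omega)]
        simp
      · rw [NSym.perpCoeff_of_le_nil h]
        simp [eq_comm]
    | cons g γ =>
      have hg := g.pos
      have hz : (g :: γ : Comp).map PNat.val = β.map PNat.val ↔ β = g :: γ := by
        rw [List.map_inj_right (fun _ _ h => PNat.coe_injective h), eq_comm]
      rw [insertZero_zero, pieriTerm_zero_cons, List.map_cons]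
      rw [List.map_cons] at hz
      simp only [insertZero_cons_succ, hz]
      have hgv : PNat.val g = (g : ℕ) := rfl
      rw [hgv]
      rcases lt_or_ge q b with h | h
      · rw [NSym.perpCoeff_of_lt h, if_neg (show ¬ ((b : ℕ) = q ∧ _) by omega)]
        simp only [pieriTerm_of_lt h]
        split_ifs with h1
        · rw [ih, add_zero]
        · simp
      · rw [NSym.perpCoeff_of_le h]
        simp only [pieriTerm_of_le h _ hg]
        simp only [← PNat.coe_lt_coe]
        by_cases h1 : (b : ℕ) < g
        · simp only [if_pos h1]
          rw [ih, Finset.sum_neg_distrib]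
          push_cast
          ring
        · simp only [if_neg h1]
          simp

theorem Comp.part_cons_one (b : ℕ+) (β : Comp) : Comp.part (b :: β) 1 = b := rfl

theorem Comp.part_cons_add_two (b : ℕ+) (β : Comp) (i : ℕ) :
    Comp.part (b :: β) (i + 2) = β.part (i + 1) := rfl

theorem Comp.part_succ_of_lt {α : Comp} {i : ℕ} (h : i < α.length) : α.part (i + 1) = α[i] := by
  simp [Comp.part, h]

theorem Comp.part_of_gt {α : Comp} {i : ℕ} (h : α.length < i) : α.part i = 0 := by
  simp [Comp.part, h]

theorem Comp.part_pos {α : Comp} {i : ℕ} (h : i < α.length) : 0 < α.part (i + 1) := by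
  rw [Comp.part_succ_of_lt h]; exact PNat.pos _

theorem Comp.size_cons (b : ℕ+) (β : Comp) : Comp.size (b :: β) = b + β.size := by
  simp [Comp.size]

/-! ### Cancellation between the positions of the zero -/

/-- The factor that the pair `(b, d)` contributes to `pieriTerm`, at excess `q`. -/
def stepSign (q b d : ℕ) : ℤ :=
  if q < b then if d ≤ b ∧ b ≤ q + d then 1 else 0 else if b < d then -1 else 0

theorem pieriTerm_cons_pos (q : ℕ) (b : ℕ+) (β : Comp) {d : ℕ} (hd : 0 < d) (δ : List ℕ) :
    pieriTerm q (b :: β) (d :: δ) = stepSign q b d * pieriTerm (q + d - b) β δ := by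
  unfold stepSign
  rcases lt_or_ge q b with h | h
  · rw [pieriTerm_of_lt h, if_pos h]; split_ifs <;> simp
  · rw [pieriTerm_of_le h _ hd]
    simp only [if_neg (show ¬ q < (b : ℕ) by omega)]
    split_ifs <;> simp

theorem pieriVec_of_pieriTerm_ne_zero {q : ℕ} {β : Comp} {δ : List ℕ}
    (h : pieriTerm q β δ ≠ 0) : PieriVec q β δ := by
  by_contra h'
  exact h (if_neg h')

/-- After a zero, δ must copy the rest of β. -/
theorem drop_eq_of_pieriTerm_ne_zero {i q : ℕ} {β γ : Comp} (hi : i < β.length)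
    (h : pieriTerm q β (insertZero (γ.map PNat.val) i) ≠ 0) : γ.drop i = β.drop (i + 1) := by
  induction i generalizing q β γ with
  | zero =>
    cases β with
    | nil => simp at hi
    | cons b β =>
      rw [insertZero_zero, pieriTerm_zero_cons] at h
      have := (Ne.ite_ne_right_iff one_ne_zero).1 h
      rw [List.map_inj_right (fun _ _ h => PNat.coe_injective h)] at this
      exact this.2
  | succ i ih =>
    cases β with
    | nil => simp at hi
    | cons b β =>
      cases γ with
      | nil =>
        rw [List.map_nil, insertZero_nil, pieriTerm_zero_cons] at h
        have := congrArg List.length ((Ne.ite_ne_right_iff one_ne_zero).1 h).2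
        simp only [List.length_nil, List.length_map] at this
        rw [List.length_cons] at hi
        omega
      | cons g γ =>
        rw [List.map_cons, insertZero_cons_succ, pieriTerm_cons_pos _ _ _ g.pos] at h
        exact ih (by simpa using hi) (right_ne_zero_of_mul h)

/-- Let b < c be the two parts concerned. Both (0, c) and (c, 0) are admissible exactly when the
excess there is b: c > b forces the high step, which carries the excess from b to c and contributes
the factor -1. -/
theorem pieriTerm_insertZero_succ {i q : ℕ} {β γ : Comp} (hi : i + 1 < β.length)
    (hd : γ.drop i = β.drop (i + 1)) (hlt : β.part (i + 1) < β.part (i + 2)) :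
    pieriTerm q β (insertZero (γ.map PNat.val) (i + 1)) =
      - pieriTerm q β (insertZero (γ.map PNat.val) i) := by
  induction i generalizing q β γ with
  | zero =>
    obtain ⟨b, c, t, rfl⟩ : ∃ b c t, β = b :: c :: t := by
      rcases β with _ | ⟨b, _ | ⟨c, t⟩⟩
      · simp at hi
      · simp at hi
      · exact ⟨b, c, t, rfl⟩
    obtain rfl : γ = c :: t := by simpa using hd
    have hlt' : (b : ℕ) < c := hlt
    rw [List.map_cons, insertZero_cons_succ, insertZero_zero, insertZero_zero,
      pieriTerm_cons_pos _ _ _ c.pos, pieriTerm_zero_cons, pieriTerm_zero_cons, stepSign]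
    simp only [List.map_cons, and_true]
    split_ifs <;> omega
  | succ i ih =>
    obtain ⟨b, β, rfl⟩ : ∃ b t, β = b :: t := by
      rcases β with _ | ⟨b, t⟩
      · simp at hi
      · exact ⟨b, t, rfl⟩
    cases γ with
    | nil =>
      have := congrArg List.length hd
      simp at this hi
      omega
    | cons g γ =>
      rw [List.map_cons, insertZero_cons_succ, insertZero_cons_succ,
        pieriTerm_cons_pos _ _ _ g.pos, pieriTerm_cons_pos _ _ _ g.pos,
        ih (by simpa using hi) (by simpa using hd) hlt, mul_neg]

theorem sum_insertZero (γ : List ℕ) (i : ℕ) : (insertZero γ i).sum = γ.sum := by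
  rw [insertZero, List.sum_append, List.sum_cons, zero_add, List.sum_take_add_sum_drop]

theorem pieriTerm_insertZero_eq_zero {i k q : ℕ} {β γ : Comp} (hi : i < β.length) (hk : k < i)
    (hd : γ.drop k = β.drop (k + 1)) (hle : β.part (k + 2) ≤ β.part (k + 1)) :
    pieriTerm q β (insertZero (γ.map PNat.val) i) = 0 := by
  induction k generalizing q i β γ with
  | zero =>
    obtain ⟨i, rfl⟩ : ∃ j, i = j + 1 := ⟨i - 1, by omega⟩
    obtain ⟨b, c, t, rfl⟩ : ∃ b c t, β = b :: c :: t := by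
      rcases β with _ | ⟨b, _ | ⟨c, t⟩⟩
      · simp at hi
      · simp at hi
      · exact ⟨b, c, t, rfl⟩
    obtain rfl : γ = c :: t := by simpa using hd
    have hle' : (c : ℕ) ≤ b := hle
    have hc : PNat.val c = (c : ℕ) := rfl
    by_contra hne
    have h := pieriVec_of_pieriTerm_ne_zero hne
    have hs := h.sum_eq
    rw [sum_insertZero, Comp.size_cons] at hs
    -- The total size fixes the excess: the tail of β equals γ, so only b remains for q.
    have hs' : q = b := by
      change q + Comp.size (c :: t) = _ at hs
      omega
    rw [List.map_cons, insertZero_cons_succ] at h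
    have h3 := h.2.2.1 hs'.symm
    have := c.pos
    omega
  | succ k ih =>
    obtain ⟨b, β, rfl⟩ : ∃ b t, β = b :: t := by
      rcases β with _ | ⟨b, t⟩
      · simp at hi
      · exact ⟨b, t, rfl⟩
    obtain ⟨i, rfl⟩ : ∃ j, i = j + 1 := ⟨i - 1, by omega⟩
    cases γ with
    | nil =>
      have := congrArg List.length hd
      simp at this hi
      omega
    | cons g γ =>
      rw [List.map_cons, insertZero_cons_succ, pieriTerm_cons_pos _ _ _ g.pos,
        ih (by simpa using hi) (by omega) (by simpa using hd) hle, mul_zero]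

/-- A sum whose terms alternate on `[k, r]` and vanish elsewhere. -/
theorem sum_range_alternating {n k r : ℕ} {f : ℕ → ℤ} (hkr : k ≤ r) (hr : r < n)
    (h1 : ∀ i, i < k → f i = 0) (h2 : ∀ i, r < i → i < n → f i = 0)
    (h3 : ∀ i, k ≤ i → i < r → f (i + 1) = - f i) :
    ∑ i ∈ Finset.range n, f i = if Even (r - k) then f k else 0 := by
  have h4 : ∀ m, k + m ≤ r → ∑ i ∈ Finset.range (k + m + 1), f i =
      (if Even m then f k else 0) ∧ f (k + m) = (-1) ^ m * f k := by
    intro m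
    induction m with
    | zero =>
      intro _
      rw [add_zero, Finset.sum_range_succ, Finset.sum_eq_zero fun i hi =>
        h1 i (Finset.mem_range.1 hi)]
      simp
    | succ m ih =>
      intro hm
      obtain ⟨ih1, ih2⟩ := ih (by omega)
      have h5 := h3 (k + m) (by omega) (by omega)
      rw [ih2] at h5
      constructor
      · rw [Finset.sum_range_succ, ← add_assoc k m 1, ih1, h5]
        rcases Nat.even_or_odd m with h | h
        · rw [if_pos h, if_neg (by simpa [Nat.even_add_one] using h), h.neg_one_pow]; ring
        · rw [if_neg (by simpa using h), if_pos h.add_one, h.neg_one_pow]; ring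
      · rw [← add_assoc, h5, pow_succ]; ring
  have h5 := (h4 (r - k) (by omega)).1
  rw [show k + (r - k) + 1 = r + 1 by omega] at h5
  rw [← h5, ← Finset.sum_range_add_sum_Ico _ (show r + 1 ≤ n by omega),
    Finset.sum_eq_zero (s := Finset.Ico _ _) fun i hi => h2 i
      (by have := Finset.mem_Ico.1 hi; omega) (Finset.mem_Ico.1 hi).2, add_zero]

theorem drop_eq_drop_iff {β γ : Comp} (h : γ.length + 1 = β.length) (g : ℕ+) {i : ℕ} :
    γ.drop i = β.drop (i + 1) ↔
      ∀ j, i + 1 < j → j ≤ β.length → β.part j = Comp.part (g :: γ) j := by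
  constructor
  · intro h1 j hj hj'
    obtain ⟨m, rfl⟩ : ∃ m, j = i + m + 2 := ⟨j - i - 2, by omega⟩
    rw [Comp.part_cons_add_two, Comp.part_succ_of_lt (i := i + m + 1) (by omega),
      Comp.part_succ_of_lt (by omega)]
    have h2 : (γ.drop i)[m]? = (β.drop (i + 1))[m]? := by rw [h1]
    rw [List.getElem?_drop, List.getElem?_drop, List.getElem?_eq_getElem (by omega),
      List.getElem?_eq_getElem (by omega)] at h2
    have h3 := Option.some_injective _ h2
    rw [h3]
    congr 2
    omega
  · intro h1
    apply List.ext_getElem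
    · simp; omega
    · intro m hm1 hm2
      simp only [List.length_drop] at hm1 hm2
      rw [List.getElem_drop, List.getElem_drop]
      have h2 := h1 (i + m + 2) (by omega) (by omega)
      rw [Comp.part_cons_add_two, Comp.part_succ_of_lt (i := i + m + 1) (by omega),
        Comp.part_succ_of_lt (by omega)] at h2
      have h3 := PNat.coe_injective h2
      rw [← h3]
      congr 1
      omega

theorem kIndex_mem {β γ : Comp} (h : 1 ≤ β.length) :
    kIndex β γ ∈ {k | 1 ≤ k ∧ k ≤ β.length ∧ ∀ j, k < j → j ≤ β.length → β.part j = γ.part j} :=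
  Nat.sInf_mem ⟨β.length, h, le_rfl, fun _ _ _ => by omega⟩

theorem rIndex_mem {β γ : Comp} (h : 1 ≤ β.length) :
    rIndex β γ ∈ {r | kIndex β γ ≤ r ∧ r ≤ β.length ∧
      ∀ j, kIndex β γ ≤ j → j < r → β.part j < β.part (j + 1)} :=
  Nat.sSup_mem ⟨kIndex β γ, le_rfl, (kIndex_mem h).2.1, fun _ _ _ => by omega⟩
    ⟨β.length, fun _ hr => hr.2.1⟩

/-- Minimality of k kills the earlier positions, and the failure of the increase after r kills the
later ones. Between them the terms alternate, so an even number of steps leaves the first term and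
an odd number leaves nothing. -/
theorem sum_pieriTerm_insertZero (q : ℕ) {β γ : Comp} (g : ℕ+) (h : γ.length + 1 = β.length) :
    ∑ i ∈ Finset.range β.length, pieriTerm q β (insertZero (γ.map PNat.val) i) =
      if Even (rIndex β (g :: γ) - kIndex β (g :: γ)) then
        pieriTerm q β (insertZero (γ.map PNat.val) (kIndex β (g :: γ) - 1)) else 0 := by
  obtain ⟨hk1, hk2, hk3⟩ := kIndex_mem (β := β) (γ := g :: γ) (by omega)
  obtain ⟨hr1, hr2, hr3⟩ := rIndex_mem (β := β) (γ := g :: γ) (by omega)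
  have hkmin : ∀ k, 1 ≤ k → k ≤ β.length →
      (∀ j, k < j → j ≤ β.length → β.part j = Comp.part (g :: γ) j) → kIndex β (g :: γ) ≤ k :=
    fun k h1 h2 h3 => Nat.sInf_le ⟨h1, h2, h3⟩
  have hrmax : ∀ r, kIndex β (g :: γ) ≤ r → r ≤ β.length →
      (∀ j, kIndex β (g :: γ) ≤ j → j < r → β.part j < β.part (j + 1)) →
      r ≤ rIndex β (g :: γ) :=
    fun r h1 h2 h3 => le_csSup ⟨β.length, fun _ hr => hr.2.1⟩ ⟨h1, h2, h3⟩
  set k := kIndex β (g :: γ)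
  set r := rIndex β (g :: γ)
  have hdrop : ∀ i, k - 1 ≤ i → γ.drop i = β.drop (i + 1) := fun i hi =>
    (drop_eq_drop_iff h g).2 fun j hj hj' => hk3 j (by omega) hj'
  -- Positions of the zero count the entries before it, after removal of γ_1, hence k - 1 and r - 1.
  rw [sum_range_alternating (k := k - 1) (r := r - 1) (by omega) (by omega),
    show r - 1 - (k - 1) = r - k by omega]
  · intro i hi
    by_contra hne
    have := hkmin (i + 1) (by omega) (by omega)
      ((drop_eq_drop_iff h g).1 (drop_eq_of_pieriTerm_ne_zero (by omega) hne))
    omega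
  · intro i hi hi'
    refine pieriTerm_insertZero_eq_zero hi' hi (hdrop _ (by omega)) ?_
    by_contra hlt
    have := hrmax (r + 1) (by omega) (by omega) fun j hj hj' => by
      rcases Nat.lt_or_ge j r with hjr | hjr
      · exact hr3 j hj hjr
      · obtain rfl : j = r := by omega
        rw [show r - 1 + 2 = r + 1 by omega, show r - 1 + 1 = r by omega] at hlt
        omega
    omega
  · intro i hi hi'
    refine pieriTerm_insertZero_succ (by omega) (hdrop i hi) ?_
    exact hr3 (i + 1) (by omega) (by omega)

/-! ### Signs, and the inequalities in closed form -/

theorem sgnVec_nil : sgnVec [] = 1 := rfl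

theorem sgnVec_cons (a : ℤ) (v : List ℤ) :
    sgnVec (a :: v) = (if a < 0 then -1 else 1) * sgnVec v := by
  unfold sgnVec
  rw [List.countP_cons]
  by_cases h : a < 0
  · simp [h, pow_succ]
  · simp [h]

theorem diffSign_eq_sgnVec {β : Comp} {δ : List ℕ} (h : δ.length = β.length) :
    diffSign β δ = sgnVec ((List.range β.length).map fun i =>
      (β.part (i + 1) : ℤ) - (δ.getD i 0 : ℤ)) := by
  induction β generalizing δ with
  | nil => cases δ <;> rfl
  | cons b β ih =>
    cases δ with
    | nil => simp at h
    | cons d δ =>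
      rw [List.length_cons, List.range_succ_eq_map, List.map_cons, sgnVec_cons, diffSign,
        ih (by simpa using h), List.map_map]
      congr 1
      simp [Comp.part_cons_one]

/-- From the zero onwards no entry of δ exceeds that of β, so only the entries before it contribute
signs. -/
theorem diffSign_insertZero {β γ : Comp} (g : ℕ+) {i : ℕ} (h : γ.length + 1 = β.length)
    (hi : i < β.length) (hd : γ.drop i = β.drop (i + 1)) :
    diffSign β (insertZero (γ.map PNat.val) i) = sgnVec (shiftedDiff β (g :: γ) i) := by
  induction i generalizing β γ g with
  | zero =>
    obtain ⟨b, β, rfl⟩ : ∃ b t, β = b :: t := by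
      rcases β with _ | ⟨b, t⟩
      · simp at hi
      · exact ⟨b, t, rfl⟩
    obtain rfl : γ = β := by simpa using hd
    rw [insertZero_zero, diffSign, diffSign_self]
    simp [shiftedDiff, sgnVec_nil]
  | succ i ih =>
    obtain ⟨b, β, rfl⟩ : ∃ b t, β = b :: t := by
      rcases β with _ | ⟨b, t⟩
      · simp at hi
      · exact ⟨b, t, rfl⟩
    cases γ with
    | nil =>
      simp only [List.length_cons, List.length_nil] at h hi
      omega
    | cons c γ =>
      rw [List.map_cons, insertZero_cons_succ, diffSign,
        ih c (by simpa using h) (by simpa using hi) (by simpa using hd), shiftedDiff, shiftedDiff,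
        List.range_succ_eq_map, List.map_cons, sgnVec_cons, List.map_map]
      congr 1
      simp [Comp.part_cons_one, Comp.part_cons_add_two]

/-- The excess before position `i + 1`. -/
def excessFrom (q : ℤ) (β : Comp) (δ : List ℕ) (i : ℕ) : ℤ :=
  q + ∑ j ∈ Finset.range i, ((δ.getD j 0 : ℤ) - β.part (j + 1))

theorem excess_cons (β : Comp) (d : ℕ) (δ : List ℕ) (i : ℕ) :
    excess β (d :: δ) (i + 1) = excessFrom ((d : ℤ) - 1) β δ i := by
  rw [excess, excessFrom, Finset.sum_Ico_eq_sum_range, Nat.add_sub_cancel]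
  simp [add_comm 1]

theorem excessFrom_cons_succ (q : ℤ) (b : ℕ+) (β : Comp) (d : ℕ) (δ : List ℕ) (i : ℕ) :
    excessFrom q (b :: β) (d :: δ) (i + 1) = excessFrom (q + d - b) β δ i := by
  rw [excessFrom, excessFrom, Finset.sum_range_succ']
  simp only [List.getD_cons_succ, List.getD_cons_zero, Comp.part_cons_add_two, zero_add,
    Comp.part_cons_one]
  ring

/-- The conditions of `NumericConditions` at position `i + 1`, for an arbitrary initial excess. -/
def NumericAt (q : ℤ) (β : Comp) (δ : List ℕ) (i : ℕ) : Prop :=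
  ((β.part (i + 1) : ℤ) < excessFrom q β δ i → β.part (i + 1) < δ.getD i 0) ∧
  (excessFrom q β δ i < β.part (i + 1) → δ.getD i 0 ≤ β.part (i + 1) ∧
    (β.part (i + 1) : ℤ) - excessFrom q β δ i ≤ δ.getD i 0) ∧
  ((β.part (i + 1) : ℤ) = excessFrom q β δ i → β.part (i + 1) < δ.getD i 0 ∨
    (δ.getD i 0 = 0 ∧ ∀ j, i < j → j < β.length → β.part (j + 1) = δ.getD j 0))

theorem numericAt_cons_succ (q : ℤ) (b : ℕ+) (β : Comp) (d : ℕ) (δ : List ℕ) (i : ℕ) :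
    NumericAt q (b :: β) (d :: δ) (i + 1) ↔ NumericAt (q + d - b) β δ i := by
  have h : (∀ j, i + 1 < j → j < (b :: β : Comp).length →
      Comp.part (b :: β) (j + 1) = (d :: δ).getD j 0) ↔
      ∀ j, i < j → j < β.length → β.part (j + 1) = δ.getD j 0 := by
    constructor
    · intro h j hj hj'
      exact h (j + 1) (by omega) (by simpa using hj')
    · intro h j hj hj'
      obtain ⟨j, rfl⟩ : ∃ m, j = m + 1 := ⟨j - 1, by omega⟩
      exact h j (by omega) (by simpa using hj')
  unfold NumericAt
  rw [h]
  simp only [excessFrom_cons_succ, Comp.part_cons_add_two, List.getD_cons_succ]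

theorem eq_map_val_iff {β : Comp} {δ : List ℕ} (h : δ.length = β.length) :
    δ = β.map PNat.val ↔ ∀ j, j < β.length → β.part (j + 1) = δ.getD j 0 := by
  constructor
  · rintro rfl j _
    rfl
  · intro h1
    apply List.ext_getElem
    · simpa using h
    · intro j hj1 hj2
      have := h1 j (by omega)
      rw [Comp.part_succ_of_lt (by omega)] at this
      simp [List.getD_eq_getElem?_getD, hj1] at this
      simp [this]

/-- Unrolling the recursion turns the running excess into `excessFrom`, and its final vanishing into
the condition on the sum. -/
theorem pieriVec_iff {q : ℕ} {β : Comp} {δ : List ℕ} (h : δ.length = β.length) :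
    PieriVec q β δ ↔ q + δ.sum = β.size ∧ ∀ i, i < β.length → NumericAt q β δ i := by
  induction β generalizing q δ with
  | nil =>
    obtain rfl : δ = [] := by simpa using h
    simp [PieriVec, Comp.size]
  | cons b β ih =>
    cases δ with
    | nil => simp at h
    | cons d δ =>
      have h' : δ.length = β.length := by simpa using h
      rw [PieriVec, ih h', List.length_cons, Nat.forall_lt_succ_left']
      simp only [numericAt_cons_succ, Comp.size_cons, List.sum_cons]
      have h0 : NumericAt q (b :: β) (d :: δ) 0 ↔ ((b : ℕ) < q → (b : ℕ) < d) ∧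
          (q < b → d ≤ b ∧ (b : ℕ) ≤ q + d) ∧
          ((b : ℕ) = q → (b : ℕ) < d ∨ (d = 0 ∧ δ = β.map PNat.val)) := by
        rw [eq_map_val_iff h']
        have h2 : (∀ j, 0 < j → j < (b :: β : Comp).length →
            Comp.part (b :: β) (j + 1) = (d :: δ).getD j 0) ↔
            ∀ j, j < β.length → Comp.part β (j + 1) = δ.getD j 0 := by
          constructor
          · intro h j hj
            exact h (j + 1) (by omega) (by simpa using hj)
          · intro h j hj hj'
            obtain ⟨j, rfl⟩ : ∃ m, j = m + 1 := ⟨j - 1, by omega⟩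
            exact h j (by simpa using hj')
        unfold NumericAt
        rw [h2]
        simp only [excessFrom, Finset.range_zero, Finset.sum_empty, add_zero, zero_add,
          Comp.part_cons_one, List.getD_cons_zero, Nat.cast_lt, Nat.cast_inj, sub_le_iff_le_add]
        norm_cast
        rw [add_comm d q]
      rw [h0]
      constructor
      · rintro ⟨h1, h2, h3, h4, h5⟩
        -- In each of the three cases the natural subtraction in the new excess is not truncated.
        have hb : (b : ℕ) ≤ q + d := by omega
        refine ⟨by omega, ⟨h1, h2, h3⟩, fun i hi => ?_⟩
        have := h5 i hi
        rwa [Nat.cast_sub hb, Nat.cast_add] at this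
      · rintro ⟨h4, ⟨h1, h2, h3⟩, h5⟩
        have hb : (b : ℕ) ≤ q + d := by omega
        refine ⟨h1, h2, h3, by omega, fun i hi => ?_⟩
        rw [Nat.cast_sub hb, Nat.cast_add]
        exact h5 i hi

theorem numericConditions_cons_iff {β : Comp} {d : ℕ} {δ : List ℕ} :
    NumericConditions β (d :: δ) ↔ ∀ i, i < β.length → NumericAt ((d : ℤ) - 1) β δ i := by
  have key : ∀ i, (∀ j, i + 1 < j → j ≤ β.length → β.part j = (d :: δ).getD j 0) ↔
      ∀ j, i < j → j < β.length → β.part (j + 1) = δ.getD j 0 := by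
    intro i
    constructor
    · intro h j hj hj'
      exact h (j + 1) (by omega) (by omega)
    · intro h j hj hj'
      obtain ⟨j, rfl⟩ : ∃ m, j = m + 1 := ⟨j - 1, by omega⟩
      exact h j (by omega) (by omega)
  constructor
  · intro h i hi
    have := h (i + 1) (by omega) (by omega)
    rwa [key, excess_cons, List.getD_cons_succ] at this
  · intro h i hi hi'
    obtain ⟨i, rfl⟩ : ∃ m, i = m + 1 := ⟨i - 1, by omega⟩
    rw [key, excess_cons, List.getD_cons_succ]
    exact h i (by omega)

theorem pieriVec_iff_numericConditions {β : Comp} {d : ℕ} (hd : 1 ≤ d) {δ : List ℕ}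
    (h : δ.length = β.length) : PieriVec (d - 1) β δ ↔
      (d :: δ).sum = β.size + 1 ∧ NumericConditions β (d :: δ) := by
  rw [pieriVec_iff h, numericConditions_cons_iff, List.sum_cons, Nat.cast_sub hd, Nat.cast_one]
  refine and_congr ?_ Iff.rfl
  omega

/-! ### High and low indices, and the forced permutation -/

/-- Two sequences `b` and `d` (supported on `[1, n]` and `[0, n]`) subject to the numerical
conditions of the left Pieri rule. -/
structure ExcessData where
  n : ℕ
  b : ℕ → ℕ
  d : ℕ → ℕ
  b_pos : ∀ i, 1 ≤ i → i ≤ n → 0 < b i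
  d_out : ∀ i, n < i → d i = 0
  excess_end : (d 0 : ℤ) + ∑ j ∈ Finset.Ico 1 (n + 1), ((d j : ℤ) - b j) = 0
  numeric : ∀ i, 1 ≤ i → i ≤ n →
    ((b i : ℤ) < (d 0 : ℤ) + ∑ j ∈ Finset.Ico 1 i, ((d j : ℤ) - b j) → b i < d i) ∧
    ((d 0 : ℤ) + ∑ j ∈ Finset.Ico 1 i, ((d j : ℤ) - b j) < b i → d i ≤ b i ∧
      (b i : ℤ) - ((d 0 : ℤ) + ∑ j ∈ Finset.Ico 1 i, ((d j : ℤ) - b j)) ≤ d i) ∧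
    ((b i : ℤ) = (d 0 : ℤ) + ∑ j ∈ Finset.Ico 1 i, ((d j : ℤ) - b j) → b i < d i ∨
      (d i = 0 ∧ ∀ j, i < j → j ≤ n → b j = d j))

namespace ExcessData

variable (D : ExcessData)

/-- The excess. -/
def Q (i : ℕ) : ℤ := (D.d 0 : ℤ) + ∑ j ∈ Finset.Ico 1 i, ((D.d j : ℤ) - D.b j)

theorem Q_one : D.Q 1 = D.d 0 := by simp [Q]

theorem Q_succ {i : ℕ} (hi : 1 ≤ i) : D.Q (i + 1) = D.Q i + D.d i - D.b i := by
  rw [Q, Q, Finset.sum_Ico_succ_top hi]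
  ring

theorem Q_end : D.Q (D.n + 1) = 0 := D.excess_end

theorem numericQ {i : ℕ} (h1 : 1 ≤ i) (h2 : i ≤ D.n) :
    ((D.b i : ℤ) < D.Q i → D.b i < D.d i) ∧
    (D.Q i < D.b i → D.d i ≤ D.b i ∧ (D.b i : ℤ) - D.Q i ≤ D.d i) ∧
    ((D.b i : ℤ) = D.Q i → D.b i < D.d i ∨ (D.d i = 0 ∧ ∀ j, i < j → j ≤ D.n → D.b j = D.d j)) :=
  D.numeric i h1 h2

theorem low_cases {i : ℕ} (h1 : 1 ≤ i) (h2 : i ≤ D.n) (h : D.d i ≤ D.b i) :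
    (D.Q i < D.b i ∧ (D.b i : ℤ) - D.Q i ≤ D.d i) ∨
      ((D.b i : ℤ) = D.Q i ∧ D.d i = 0 ∧ ∀ j, i < j → j ≤ D.n → D.b j = D.d j) := by
  obtain ⟨a1, a2, a3⟩ := D.numericQ h1 h2
  rcases lt_trichotomy (D.b i : ℤ) (D.Q i) with hlt | heq | hgt
  · have := a1 hlt; omega
  · rcases a3 heq with h4 | h4
    · omega
    · exact Or.inr ⟨heq, h4⟩
  · exact Or.inl ⟨hgt, (a2 hgt).2⟩

theorem Q_nonneg {i : ℕ} (h1 : 1 ≤ i) (h2 : i ≤ D.n + 1) : 0 ≤ D.Q i := by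
  induction i, h1 using Nat.le_induction with
  | base => rw [Q_one]; positivity
  | succ i h1 ih =>
    have ih := ih (by omega)
    obtain ⟨a1, a2, a3⟩ := D.numericQ h1 (by omega)
    rw [D.Q_succ h1]
    rcases lt_trichotomy (D.b i : ℤ) (D.Q i) with hlt | heq | hgt
    · have := a1 hlt; omega
    · omega
    · have := a2 hgt; omega

/-- The excess is nonnegative before n and zero after it. Thus every high index is followed by a low
one inside [1, n]. -/
theorem low_last (h : 1 ≤ D.n) : D.d D.n ≤ D.b D.n := by
  have h1 := D.Q_nonneg h (by omega)
  have h2 := D.Q_succ h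
  rw [Q_end] at h2
  omega

theorem exists_low (m : ℕ) : ∃ i, m < i ∧ D.d i ≤ D.b i :=
  ⟨m + D.n + 1, by omega, by rw [D.d_out _ (by omega)]; omega⟩

/-- The first index `i > m` with `d i ≤ b i`. -/
def nxt (m : ℕ) : ℕ := Nat.find (D.exists_low m)

theorem lt_nxt (m : ℕ) : m < D.nxt m := (Nat.find_spec (D.exists_low m)).1

theorem low_nxt (m : ℕ) : D.d (D.nxt m) ≤ D.b (D.nxt m) := (Nat.find_spec (D.exists_low m)).2

theorem nxt_le {m i : ℕ} (h : m < i) (hi : D.d i ≤ D.b i) : D.nxt m ≤ i :=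
  Nat.find_min' _ ⟨h, hi⟩

theorem high_of_lt_nxt {m i : ℕ} (h : m < i) (hi : i < D.nxt m) : D.b i < D.d i := by
  by_contra hc
  have := D.nxt_le h (by omega)
  omega

theorem nxt_le_n {m : ℕ} (h : m < D.n) : D.nxt m ≤ D.n := D.nxt_le h (D.low_last (by omega))

/-- The value that the permutation of a surviving tableau takes at the first `j ≥ i` with
`d j ≤ b j`. -/
def hole : ℕ → ℕ
  | 0 => 1
  | i + 1 => if i = 0 ∨ D.d i ≤ D.b i then i + 1 else hole i

theorem hole_one : D.hole 1 = 1 := by simp [hole]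

theorem hole_succ {i : ℕ} (hi : 1 ≤ i) :
    D.hole (i + 1) = if D.d i ≤ D.b i then i + 1 else D.hole i := by
  rw [hole]
  simp [show i ≠ 0 by omega]

theorem hole_le {i : ℕ} (hi : 1 ≤ i) : D.hole i ≤ i := by
  induction i, hi using Nat.le_induction with
  | base => rw [hole_one]
  | succ i h1 ih => rw [D.hole_succ h1]; split_ifs <;> omega

/-- The one-line notation of the permutation of a surviving tableau. -/
def perm (i : ℕ) : ℕ := if D.d i ≤ D.b i then D.hole i else i + 1

/-- A high k has σ(k) = k + 1. A low k ≥ 1 has σ(k) = `hole k` ≤ k. So the set in question consists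
of 1 and the successors of the low indices below i. -/
theorem isGreatest_hole {σ : ℕ → ℤ} {i : ℕ} (hi : 1 ≤ i)
    (h : ∀ k, 1 ≤ k → k < i → σ k = D.perm k) :
    IsGreatest {m : ℤ | ∃ k < i, m = k + 1 ∧ (k = 0 ∨ σ k ≠ k + 1)} (D.hole i) := by
  induction i, hi using Nat.le_induction with
  | base =>
    refine ⟨⟨0, by omega, by simp [hole_one], Or.inl rfl⟩, ?_⟩
    rintro m ⟨k, hk, rfl, -⟩
    rw [hole_one]; push_cast; omega
  | succ i h1 ih =>
    obtain ⟨⟨k, hk, hk1, hk2⟩, ih2⟩ := ih fun k hk hk' => h k hk (by omega)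
    have h3 := h i h1 (by omega)
    rw [perm] at h3
    rw [D.hole_succ h1]
    have := D.hole_le h1
    split_ifs at h3 ⊢ with h4
    · refine ⟨⟨i, by omega, by push_cast; ring, Or.inr (by omega)⟩, ?_⟩
      rintro m ⟨l, hl, rfl, -⟩
      push_cast; omega
    · refine ⟨⟨k, by omega, hk1, hk2⟩, ?_⟩
      rintro m ⟨l, hl, rfl, hl'⟩
      rcases Nat.lt_or_ge l i with hli | hli
      · exact ih2 ⟨l, hli, rfl, hl'⟩
      · obtain rfl : l = i := by omega
        rcases hl' with hl' | hl'
        · omega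
        · exact absurd (by push_cast at h3; exact h3) hl'

/-- Scan from left to right: the values below position k are final, position k (counted from 0)
holds the free value, and later positions are fixed. A high index swaps the free value one place on
and changes the sign; a low index keeps it. -/
theorem exists_perm_aux {k : ℕ} (hk : k ≤ D.n) : ∃ π : Equiv.Perm (Fin D.n),
    (∀ i : Fin D.n, (i : ℕ) < k → (π i : ℕ) + 1 = D.perm (i + 1)) ∧
    (∀ i : Fin D.n, (i : ℕ) = k → (π i : ℕ) + 1 = D.hole (i + 1)) ∧
    (∀ i : Fin D.n, k < (i : ℕ) → π i = i) ∧
    (Equiv.Perm.sign π : ℤ) =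
      ∏ i ∈ Finset.range k, if D.d (i + 1) ≤ D.b (i + 1) then 1 else -1 := by
  induction k with
  | zero =>
    refine ⟨1, by simp, fun i hi => ?_, by simp, by simp⟩
    rw [hi, zero_add, hole_one]
    simp [hi]
  | succ k ih =>
    obtain ⟨π, p1, p2, p3, p4⟩ := ih (by omega)
    by_cases h : D.d (k + 1) ≤ D.b (k + 1)
    · refine ⟨π, fun i hi => ?_, fun i hi => ?_, fun i hi => p3 i (by omega), ?_⟩
      · rcases Nat.lt_or_ge i k with hik | hik
        · exact p1 i hik
        · have hik' : (i : ℕ) = k := by omega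
          rw [p2 i hik', hik', perm, if_pos h]
      · rw [p3 i (by omega), hi, D.hole_succ (by omega), if_pos h]
      · rw [Finset.prod_range_succ, if_pos h, mul_one, p4]
    · have hkn : k + 1 < D.n := by
        rcases Nat.lt_or_ge (k + 1) D.n with h' | h'
        · exact h'
        · have : k + 1 = D.n := by omega
          rw [this] at h
          exact absurd (D.low_last (by omega)) h
      set x : Fin D.n := ⟨k, by omega⟩ with hx
      set y : Fin D.n := ⟨k + 1, hkn⟩ with hy
      have hxy : x ≠ y := by simp [hx, hy]
      refine ⟨π * Equiv.swap x y, fun i hi => ?_, fun i hi => ?_, fun i hi => ?_, ?_⟩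
      · rcases Nat.lt_or_ge i k with hik | hik
        · rw [Equiv.Perm.mul_apply, Equiv.swap_apply_of_ne_of_ne, p1 i hik]
          · rintro rfl; simp [hx] at hik
          · rintro rfl; simp [hy] at hik
        · obtain rfl : i = x := by ext; simp [hx]; omega
          rw [Equiv.Perm.mul_apply, Equiv.swap_apply_left, p3 y (by simp [hy]), perm,
            if_neg (by simpa [hx] using h)]
      · obtain rfl : i = y := by ext; simp [hy, hi]
        rw [Equiv.Perm.mul_apply, Equiv.swap_apply_right, p2 x rfl, hi,
          D.hole_succ (i := k + 1) (by omega), if_neg h]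
      · rw [Equiv.Perm.mul_apply, Equiv.swap_apply_of_ne_of_ne, p3 i (by omega)]
        · rintro rfl; simp [hx] at hi
        · rintro rfl; simp [hy] at hi
      · rw [Finset.prod_range_succ, if_neg h, Equiv.Perm.sign_mul, Equiv.Perm.sign_swap hxy,
          Units.val_mul, p4]
        rfl

theorem exists_perm : ∃ π : Equiv.Perm (Fin D.n),
    (∀ i : Fin D.n, (π i : ℕ) + 1 = D.perm (i + 1)) ∧
    (Equiv.Perm.sign π : ℤ) =
      ∏ i ∈ Finset.range D.n, if D.d (i + 1) ≤ D.b (i + 1) then 1 else -1 := by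
  obtain ⟨π, p1, -, -, p4⟩ := D.exists_perm_aux le_rfl
  exact ⟨π, fun i => p1 i i.2, p4⟩

end ExcessData

/-! ### Blocks and the surviving filling -/

/-- The rows of an immaculate skew tableau of inner shape `(1)` with entries in `[1, n]`, where
block `m ≥ 1` is the row below the first one that starts with `m`, or empty. -/
structure IsBlocks (n : ℕ) (f : ℕ → List ℕ) : Prop where
  pairwise : ∀ m ≤ n, (f m).Pairwise (· ≤ ·)
  pos : ∀ m ≤ n, ∀ x ∈ f m, 0 < x
  le_n : ∀ m ≤ n, ∀ x ∈ f m, x ≤ n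
  head : ∀ m, 1 ≤ m → m ≤ n → f m ≠ [] → (f m).head? = some m

/-- The number of `i`'s in the blocks `0, …, n`. -/
def blockCount (n : ℕ) (f : ℕ → List ℕ) (i : ℕ) : ℕ := ∑ m ∈ Finset.range (n + 1), (f m).count i

/-- The number of entries `≥ i` in the blocks before block `i`. -/
def pending (f : ℕ → List ℕ) (i : ℕ) : ℕ :=
  ∑ m ∈ Finset.range i, (f m).countP fun x => decide (i ≤ x)

namespace IsBlocks

variable {n : ℕ} {f : ℕ → List ℕ} (hf : IsBlocks n f)

include hf

theorem le_entry {m : ℕ} (hm : m ≤ n) {x : ℕ} (hx : x ∈ f m) : m ≤ x := by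
  rcases Nat.eq_zero_or_pos m with rfl | hm0
  · omega
  · have h1 := hf.head m hm0 hm (List.ne_nil_of_mem hx)
    have h2 := hf.pairwise m hm
    cases hl : f m with
    | nil => rw [hl] at hx; simp at hx
    | cons y l =>
      rw [hl] at h1 h2 hx
      obtain rfl : y = m := by simpa using h1
      rcases List.mem_cons.1 hx with rfl | hx
      · rfl
      · exact (List.pairwise_cons.1 h2).1 x hx

theorem blockCount_eq {i : ℕ} (hi : i ≤ n) :
    blockCount n f i = ∑ m ∈ Finset.range (i + 1), (f m).count i := by
  rw [blockCount]
  symm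
  refine Finset.sum_subset (Finset.range_subset_range.2 (by omega)) fun m hm hm' => ?_
  simp only [Finset.mem_range] at hm hm'
  refine List.count_eq_zero_of_not_mem fun h => ?_
  have := hf.le_entry (by omega) h
  omega

theorem pending_one (h0 : 0 ≤ n) : pending f 1 = (f 0).length := by
  rw [pending, Finset.sum_range_one, List.countP_eq_length]
  intro x hx
  exact decide_eq_true (hf.pos 0 h0 x hx)

/-- On passing from i to i + 1, all of block i joins the count, as its entries are ≥ i, and every i
leaves it. -/
theorem pending_succ {i : ℕ} (hi : i ≤ n) :
    pending f (i + 1) + blockCount n f i = pending f i + (f i).length := by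
  have h1 : (f i).length = (f i).countP fun x => decide (i ≤ x) := by
    symm
    rw [List.countP_eq_length]
    intro x hx
    simpa using hf.le_entry hi hx
  rw [h1, hf.blockCount_eq hi, pending, pending, ← Finset.sum_range_succ,
    ← Finset.sum_add_distrib]
  refine Finset.sum_congr rfl fun m _ => ?_
  induction f m with
  | nil => rfl
  | cons x l ih =>
    simp only [List.countP_cons, List.count_cons, decide_eq_true_eq, beq_iff_eq]
    split_ifs <;> omega

end IsBlocks

/-- A sorted list with entries in `{x, y}`. -/
theorem List.eq_replicate_append_replicate {l : List ℕ} {x y : ℕ} (hxy : x < y)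
    (hl : l.Pairwise (· ≤ ·)) (h : ∀ z ∈ l, z = x ∨ z = y) :
    l = List.replicate (l.count x) x ++ List.replicate (l.length - l.count x) y := by
  induction l with
  | nil => rfl
  | cons z l ih =>
    obtain ⟨h1, h2⟩ := List.pairwise_cons.1 hl
    have ih := ih h2 fun w hw => h w (List.mem_cons_of_mem _ hw)
    rcases h z List.mem_cons_self with rfl | rfl
    · rw [List.count_cons_self, List.length_cons, Nat.add_sub_add_right, List.replicate_succ,
        List.cons_append, ← ih]
    · have h3 : l.count x = 0 := List.count_eq_zero_of_not_mem fun hx => by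
        have := h1 x hx; omega
      rw [h3] at ih
      rw [List.count_cons_of_ne (by omega), h3, List.length_cons]
      simp only [List.replicate_zero, List.nil_append, Nat.sub_zero] at ih ⊢
      rw [List.replicate_succ, ← ih]

namespace ExcessData

variable (D : ExcessData)

/-- The survival conditions, in terms of the blocks `f` and the sequence `σ`. -/
def BlocksSurvive (f : ℕ → List ℕ) (σ : ℕ → ℤ) : Prop :=
  ∀ i, 1 ≤ i → i ≤ D.n →
    ((D.b i : ℤ) < D.Q i →
      D.b i < D.d i ∧ σ i = i + 1 ∧ ∀ m ≤ D.n, m ≠ i → i ∉ f m) ∧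
    (D.Q i < D.b i → D.d i ≤ D.b i ∧ (D.b i : ℤ) - D.Q i ≤ D.d i ∧
      IsGreatest {m : ℤ | ∃ k < i, m = k + 1 ∧ (k = 0 ∨ σ k ≠ k + 1)} (σ i) ∧
      ∀ m < i, ∀ x ∈ f m, x ≤ i) ∧
    ((D.b i : ℤ) = D.Q i →
      (D.b i < D.d i ∧ σ i = i + 1 ∧ ∀ m ≤ D.n, m ≠ i → i ∉ f m) ∨
      (D.d i = 0 ∧ IsGreatest {m : ℤ | ∃ k < i, m = k + 1 ∧ (k = 0 ∨ σ k ≠ k + 1)} (σ i) ∧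
        ∀ j, i < j → j ≤ D.n → D.b j = D.d j ∧ σ j = j ∧ ∀ m ≤ D.n, m ≠ j → j ∉ f m))

/-- The number of `m`'s in block `m` of the surviving tableau. -/
def own (m : ℕ) : ℕ :=
  if m = 0 then 0 else if D.d m ≤ D.b m then (D.b m - D.Q m).toNat else D.b m + 1

/-- The blocks of the surviving tableau. -/
def canon (m : ℕ) : List ℕ :=
  List.replicate (D.own m) m ++ List.replicate (D.d m - D.own m) (D.nxt m)

theorem mem_canon {m x : ℕ} (h : x ∈ D.canon m) : x = m ∨ x = D.nxt m := by
  rcases List.mem_append.1 h with h | h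
  · exact Or.inl (List.eq_of_mem_replicate h)
  · exact Or.inr (List.eq_of_mem_replicate h)

theorem count_canon (m : ℕ) : (D.canon m).count m = D.own m := by
  have := D.lt_nxt m
  rw [canon, List.count_append, List.count_replicate_self, List.count_replicate]
  simp; omega

variable {D} in
theorem own_low {m : ℕ} (h1 : 1 ≤ m) (h2 : m ≤ D.n) (h : D.d m ≤ D.b m) :
    (D.own m : ℤ) = D.b m - D.Q m := by
  rw [own, if_neg (by omega), if_pos h]
  have := D.low_cases h1 h2 h
  omega

variable {D} in
theorem own_high {m : ℕ} (h1 : 1 ≤ m) (h : D.b m < D.d m) : D.own m = D.b m + 1 := by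
  rw [own, if_neg (by omega), if_neg (by omega)]

theorem own_le {m : ℕ} (h2 : m ≤ D.n) : D.own m ≤ D.d m := by
  rcases Nat.eq_zero_or_pos m with rfl | h1
  · simp [own]
  · rcases Nat.lt_or_ge (D.b m) (D.d m) with h | h
    · rw [own_high h1 h]; exact h
    · have := own_low h1 h2 h
      have := D.low_cases h1 h2 h
      omega

theorem length_canon {m : ℕ} (h2 : m ≤ D.n) : (D.canon m).length = D.d m := by
  have := D.own_le h2
  rw [canon, List.length_append, List.length_replicate, List.length_replicate]
  omega

/-- Since the excess ends at 0, the last block needs no entry larger than n. -/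
theorem own_last : D.own D.n = D.d D.n := by
  rcases Nat.eq_zero_or_pos D.n with h | h
  · have := D.Q_end
    rw [h, zero_add, Q_one] at this
    rw [h, own, if_pos rfl]
    omega
  · have h1 := own_low h le_rfl (D.low_last h)
    have h2 := D.Q_succ h
    rw [Q_end] at h2
    omega

theorem isBlocks_canon : IsBlocks D.n D.canon where
  pairwise m hm := by
    have := D.lt_nxt m
    refine List.pairwise_append.2 ⟨?_, ?_, ?_⟩
    · exact List.pairwise_replicate.2 (Or.inr le_rfl)
    · exact List.pairwise_replicate.2 (Or.inr le_rfl)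
    · intro x hx y hy
      rw [List.eq_of_mem_replicate hx, List.eq_of_mem_replicate hy]
      omega
  pos m hm x hx := by
    rcases List.mem_append.1 hx with h | h
    · obtain ⟨h1, rfl⟩ := List.mem_replicate.1 h
      by_contra h0
      exact h1 (by rw [own, if_pos (by omega)])
    · have := D.lt_nxt m
      rw [List.eq_of_mem_replicate h]; omega
  le_n m hm x hx := by
    rcases List.mem_append.1 hx with h | h
    · rw [List.eq_of_mem_replicate h]; exact hm
    · obtain ⟨h1, rfl⟩ := List.mem_replicate.1 h
      rcases hm.lt_or_eq with h2 | rfl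
      · exact D.nxt_le_n h2
      · rw [own_last] at h1; omega
  head m h1 h2 hne := by
    have h3 : D.own m ≠ 0 := by
      intro h0
      apply hne
      rw [← List.length_eq_zero_iff, D.length_canon h2]
      rcases Nat.lt_or_ge (D.b m) (D.d m) with h | h
      · rw [own_high h1 h] at h0; omega
      · have := own_low h1 h2 h
        have := D.low_cases h1 h2 h
        omega
    obtain ⟨k, hk⟩ := Nat.exists_eq_succ_of_ne_zero h3
    rw [canon, hk, List.replicate_succ]
    rfl

section Counts

variable {D} {f : ℕ → List ℕ} (hf : IsBlocks D.n f)
  (hA : ∀ m ≤ D.n, ∀ x ∈ f m, x = m ∨ x = D.nxt m)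

include hA

theorem notMem_of_high {i m : ℕ} (hi : D.b i < D.d i) (hm : m ≤ D.n) (hne : m ≠ i) :
    i ∉ f m := by
  intro h
  rcases hA m hm i h with h1 | h1
  · exact hne h1.symm
  · have := D.low_nxt m
    rw [← h1] at this
    omega

theorem blockCount_high {i : ℕ} (h2 : i ≤ D.n) (hi : D.b i < D.d i) :
    blockCount D.n f i = (f i).count i := by
  rw [blockCount, Finset.sum_eq_single_of_mem i (Finset.mem_range.2 (by omega))]
  intro m hm hne
  exact List.count_eq_zero_of_not_mem
    (notMem_of_high hA hi (by have := Finset.mem_range.1 hm; omega) hne)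

include hf

/-- For m < i with i low, the next low index after m is at most i. So every entry ≥ i in block m
equals i, and all pending entries are used up at i. -/
theorem blockCount_low {i : ℕ} (h2 : i ≤ D.n) (hi : D.d i ≤ D.b i) :
    blockCount D.n f i = pending f i + (f i).count i := by
  rw [hf.blockCount_eq h2, Finset.sum_range_succ, pending]
  congr 1
  refine Finset.sum_congr rfl fun m hm => ?_
  have hm' := Finset.mem_range.1 hm
  rw [List.count]
  refine List.countP_congr fun x hx => ?_
  have := D.nxt_le hm' hi
  have := hA m (by omega) x hx
  simp only [beq_iff_eq, decide_eq_true_eq]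
  omega

end Counts

section Pending

variable {D} {f : ℕ → List ℕ} (hf : IsBlocks D.n f) (hlen : ∀ m ≤ D.n, (f m).length = D.d m)

include hf hlen

theorem pending_step {i : ℕ} (h1 : 1 ≤ i) (h2 : i ≤ D.n)
    (hp : (pending f i : ℤ) = D.Q i - i + D.hole i)
    (hc : (blockCount D.n f i : ℤ) - D.b i + i = D.perm i) :
    (pending f (i + 1) : ℤ) = D.Q (i + 1) - (i + 1 : ℕ) + D.hole (i + 1) := by
  have h3 := hf.pending_succ h2
  rw [hlen i h2] at h3
  rw [D.Q_succ h1, D.hole_succ h1]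
  rw [perm] at hc
  split_ifs at hc ⊢ <;> push_cast <;> push_cast at hc <;> omega

theorem pending_base : (pending f 1 : ℤ) = D.Q 1 - (1 : ℕ) + D.hole 1 := by
  rw [hf.pending_one (by omega), hlen 0 (by omega), Q_one, hole_one]
  simp

/-- Block lengths and contents give pending minus excess as -∑_{j<i} (σ(j) - j). The values of σ on
[1, i-1] are {1,…,i} without `hole i`, so that sum is i - `hole i`. -/
theorem pending_eq {i : ℕ} (h1 : 1 ≤ i) (h2 : i ≤ D.n + 1)
    (hc : ∀ j, 1 ≤ j → j < i → (blockCount D.n f j : ℤ) - D.b j + j = D.perm j) :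
    (pending f i : ℤ) = D.Q i - i + D.hole i := by
  induction i, h1 using Nat.le_induction with
  | base => exact pending_base hf hlen
  | succ i h1 ih =>
    exact pending_step hf hlen h1 (by omega) (ih (by omega) fun j hj hj' => hc j hj (by omega))
      (hc i h1 (by omega))

end Pending

/-- At a low i, b_i - Q_i own entries together with the pending ones give b_i + `hole i` - i. At a
high i nothing comes from other blocks, and b_i + 1 own entries are needed. This explains `own`. -/
theorem perm_canon {i : ℕ} (h1 : 1 ≤ i) (h2 : i ≤ D.n) :
    (blockCount D.n D.canon i : ℤ) - D.b i + i = D.perm i := by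
  induction i using Nat.strong_induction_on with
  | _ i ih =>
    have hA : ∀ m ≤ D.n, ∀ x ∈ D.canon m, x = m ∨ x = D.nxt m := fun m _ x => D.mem_canon
    have hp := pending_eq D.isBlocks_canon (fun m => D.length_canon) h1 (by omega)
      fun j hj hj' => ih j hj' hj (by omega)
    rw [perm]
    split_ifs with h
    · rw [blockCount_low D.isBlocks_canon hA h2 h, count_canon]
      have := own_low h1 h2 h
      push_cast
      omega
    · rw [blockCount_high hA h2 (by omega), count_canon, own_high h1 (by omega)]
      push_cast
      ring

theorem blocksSurvive_canon {σ : ℕ → ℤ} (hσ : ∀ i, 1 ≤ i → i ≤ D.n → σ i = D.perm i) :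
    D.BlocksSurvive D.canon σ := by
  have hA : ∀ m ≤ D.n, ∀ x ∈ D.canon m, x = m ∨ x = D.nxt m := fun m _ x => D.mem_canon
  intro i h1 h2
  have hhigh : D.b i < D.d i → D.b i < D.d i ∧ σ i = i + 1 ∧
      ∀ m ≤ D.n, m ≠ i → i ∉ D.canon m := fun h =>
    ⟨h, by rw [hσ i h1 h2, perm, if_neg (by omega)]; push_cast; rfl,
      fun m hm hne => notMem_of_high hA h hm hne⟩
  have hgr : D.d i ≤ D.b i →
      IsGreatest {m : ℤ | ∃ k < i, m = k + 1 ∧ (k = 0 ∨ σ k ≠ k + 1)} (σ i) := fun h => by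
    rw [hσ i h1 h2, perm, if_pos h]
    exact D.isGreatest_hole h1 fun k hk hk' => hσ k hk (by omega)
  obtain ⟨a1, a2, a3⟩ := D.numericQ h1 h2
  refine ⟨fun h => hhigh (a1 h), fun h => ⟨(a2 h).1, (a2 h).2, hgr (a2 h).1, ?_⟩, fun h => ?_⟩
  · intro m hm x hx
    have := D.nxt_le hm (a2 h).1
    have := D.mem_canon hx
    omega
  · rcases a3 h with h3 | ⟨h3, h4⟩
    · exact Or.inl (hhigh h3)
    · refine Or.inr ⟨h3, hgr (by omega), ?_⟩
      -- The zero at i uses up the excess b_i, and equality of b and d afterwards keeps it at 0. So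
      -- each later block j consists of j's only.
      have hQ : ∀ j, i < j → j ≤ D.n → D.Q j = 0 := by
        intro j hj
        induction j, hj using Nat.le_induction with
        | base =>
          intro _
          rw [Nat.succ_eq_add_one, D.Q_succ h1]; omega
        | succ j hj ih =>
          intro hj'
          rw [D.Q_succ (by omega), ih (by omega), h4 j hj (by omega)]; ring
      have hown : ∀ j, i ≤ j → j ≤ D.n → D.own j = D.d j := by
        intro j hj hj'
        rcases hj.lt_or_eq with hlt | rfl
        · have := own_low (by omega) hj' (h4 j hlt hj').ge
          rw [hQ j hlt hj', h4 j hlt hj'] at this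
          omega
        · have := D.own_le hj'
          omega
      intro j hj hj'
      refine ⟨h4 j hj hj', ?_, ?_⟩
      · rw [hσ j (by omega) hj', perm, if_pos (h4 j hj hj').ge]
        obtain ⟨l, rfl⟩ : ∃ l, j = l + 1 := ⟨j - 1, by omega⟩
        rw [D.hole_succ (by omega), if_pos]
        rcases Nat.lt_or_ge i l with hil | hil
        · exact (h4 l hil (by omega)).ge
        · obtain rfl : l = i := by omega
          omega
      · intro m hm hne hmem
        rcases Nat.lt_or_ge m i with hmi | hmi
        · have := D.nxt_le hmi (by omega)
          have := D.mem_canon hmem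
          omega
        · rw [canon, hown m hmi hm, Nat.sub_self, List.replicate_zero, List.append_nil] at hmem
          exact hne (List.eq_of_mem_replicate hmem).symm

variable {D} in
-- Each case either prescribes σ(i) = i + 1 or determines σ(i) as a maximum over earlier values, so
-- σ is forced by induction.
theorem BlocksSurvive.perm_eq {f : ℕ → List ℕ} {σ : ℕ → ℤ} (h : D.BlocksSurvive f σ) {i : ℕ}
    (h1 : 1 ≤ i) (h2 : i ≤ D.n) : σ i = D.perm i := by
  induction i using Nat.strong_induction_on with
  | _ i ih =>
    have hgr := D.isGreatest_hole h1 fun k hk hk' => ih k hk' hk (by omega)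
    obtain ⟨a1, a2, a3⟩ := h i h1 h2
    rw [perm]
    rcases lt_trichotomy (D.b i : ℤ) (D.Q i) with hlt | heq | hgt
    · obtain ⟨b1, b2, -⟩ := a1 hlt
      rw [if_neg (by omega), b2]; push_cast; rfl
    · rcases a3 heq with ⟨b1, b2, -⟩ | ⟨b1, b2, -⟩
      · rw [if_neg (by omega), b2]; push_cast; rfl
      · rw [if_pos (by omega)]
        exact b2.unique hgr
    · obtain ⟨b1, -, b2, -⟩ := a2 hgt
      rw [if_pos b1]
      exact b2.unique hgr

variable {D} in
theorem BlocksSurvive.eq_canon {f : ℕ → List ℕ} {σ : ℕ → ℤ} (h : D.BlocksSurvive f σ)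
    (hf : IsBlocks D.n f) (hlen : ∀ m ≤ D.n, (f m).length = D.d m)
    (hσ : ∀ i, 1 ≤ i → i ≤ D.n → σ i = (blockCount D.n f i : ℤ) - D.b i + i) {m : ℕ}
    (hm : m ≤ D.n) : f m = D.canon m := by
  have hhigh : ∀ i, 1 ≤ i → i ≤ D.n → D.b i < D.d i → ∀ m ≤ D.n, m ≠ i → i ∉ f m := by
    intro i h1 h2 hi
    obtain ⟨a1, a2, a3⟩ := h i h1 h2
    rcases lt_trichotomy (D.b i : ℤ) (D.Q i) with hlt | heq | hgt
    · exact (a1 hlt).2.2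
    · rcases a3 heq with b | b
      · exact b.2.2
      · omega
    · have := (a2 hgt).1; omega
  -- An entry strictly between m and the next low index i would be high and outside its own block.
  -- An entry beyond i contradicts the bound on earlier rows at i or, in the exceptional case, the
  -- confinement of all later values to their own blocks.
  have hA : ∀ m ≤ D.n, ∀ x ∈ f m, x = m ∨ x = D.nxt m := by
    intro m hm x hx
    by_contra! hne
    have hmx := hf.le_entry hm hx
    have hxn := hf.le_n m hm x hx
    have hlt := D.lt_nxt m
    rcases lt_or_gt_of_ne hne.2 with hxi | hxi
    · exact hhigh x (by omega) hxn (D.high_of_lt_nxt (by omega) hxi) m hm hne.1.symm hx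
    · have hlow := D.low_nxt m
      set i := D.nxt m
      obtain ⟨a1, a2, a3⟩ := h i (by omega) (by omega)
      rcases lt_trichotomy (D.b i : ℤ) (D.Q i) with hlt | heq | hgt
      · have := (a1 hlt).1; omega
      · rcases a3 heq with b | b
        · omega
        · exact (b.2.2 x hxi hxn).2.2 m hm hne.1.symm hx
      · have := (a2 hgt).2.2.2 m hlt x hx
        omega
  have hc : ∀ i, 1 ≤ i → i ≤ D.n → (blockCount D.n f i : ℤ) - D.b i + i = D.perm i :=
    fun i h1 h2 => by rw [← hσ i h1 h2, h.perm_eq h1 h2]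
  -- The balance of `perm_canon`, read backwards: content and pending count determine the number of
  -- own entries.
  have hcount : (f m).count m = D.own m := by
    rcases Nat.eq_zero_or_pos m with rfl | h1
    · rw [own, if_pos rfl]
      refine List.count_eq_zero_of_not_mem fun h0 => ?_
      have := hf.pos 0 hm 0 h0
      omega
    · have hcm := hc m h1 hm
      rw [perm] at hcm
      split_ifs at hcm with hl
      · have h3 := blockCount_low hf hA hm hl
        have h4 := pending_eq hf hlen h1 (by omega) fun j hj hj' => hc j hj (by omega)
        have h5 := own_low h1 hm hl
        omega
      · have h3 := blockCount_high hA hm (by omega)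
        have h5 := own_high h1 (show D.b m < D.d m by omega)
        push_cast at hcm
        omega
  rw [List.eq_replicate_append_replicate (D.lt_nxt m) (hf.pairwise m hm) (hA m hm), hcount,
    hlen m hm, canon]

end ExcessData

/-! ### Rows of a tableau versus blocks -/

theorem List.sum_map_filter_ne_nil (g : List ℕ → ℕ) (hg : g [] = 0) (l : List (List ℕ)) :
    ((l.filter (· ≠ [])).map g).sum = (l.map g).sum := by
  induction l with
  | nil => rfl
  | cons r l ih =>
    by_cases h : r = []
    · subst h; simp [hg, ← ih]
    · simp [h, ← ih]

theorem List.sum_map_range_eq (g : ℕ → ℕ) (n : ℕ) :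
    ((List.range n).map g).sum = ∑ i ∈ Finset.range n, g i := by
  induction n with
  | zero => rfl
  | succ n ih => simp [List.range_succ, Finset.sum_range_succ, ih]

theorem List.sum_eq_sum_getD (l : List ℕ) :
    l.sum = ∑ i ∈ Finset.range l.length, l.getD i 0 := by
  induction l with
  | nil => rfl
  | cons a l ih =>
    rw [List.length_cons, Finset.sum_range_succ', List.sum_cons, ih, add_comm]
    rfl

theorem List.length_eq_sum_count {n : ℕ} {l : List ℕ} (h : ∀ x ∈ l, 0 < x ∧ x ≤ n) :
    l.length = ∑ i ∈ Finset.range n, l.count (i + 1) := by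
  induction l with
  | nil => simp
  | cons a l ih =>
    have ha := h a List.mem_cons_self
    simp only [List.count_cons, Finset.sum_add_distrib, List.length_cons,
      ← ih fun x hx => h x (List.mem_cons_of_mem _ hx)]
    rw [Finset.sum_eq_single_of_mem (a - 1) (Finset.mem_range.2 (by omega))]
    · rw [if_pos (by simp; omega)]
    · intro i _ hi
      rw [if_neg (by simp; omega)]

/-- The first list that starts with `i`, or the empty list. -/
def rowStartingWith (L : List (List ℕ)) (i : ℕ) : List ℕ :=
  (L.find? fun r => r.head? == some i).getD []

theorem rowStartingWith_eq_nil {L : List (List ℕ)} {i : ℕ} (h : ∀ r ∈ L, r.head? ≠ some i) :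
    rowStartingWith L i = [] := by
  rw [rowStartingWith, List.find?_eq_none.2 (by simpa using h)]
  rfl

theorem rowStartingWith_mem {L : List (List ℕ)} {i : ℕ} (h : rowStartingWith L i ≠ []) :
    rowStartingWith L i ∈ L ∧ (rowStartingWith L i).head? = some i := by
  unfold rowStartingWith at h ⊢
  cases hf : L.find? fun r => r.head? == some i with
  | none => rw [hf] at h; exact absurd rfl h
  | some r =>
    rw [Option.getD_some]
    exact ⟨List.mem_of_find?_eq_some hf, by simpa using List.find?_some hf⟩

theorem rowStartingWith_cons_self {L : List (List ℕ)} {r : List ℕ} {i : ℕ}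
    (h : r.head? = some i) : rowStartingWith (r :: L) i = r := by
  rw [rowStartingWith, List.find?_cons_of_pos (by simpa using h)]
  rfl

theorem rowStartingWith_cons_of_ne {L : List (List ℕ)} {r : List ℕ} {i : ℕ}
    (h : r.head? ≠ some i) : rowStartingWith (r :: L) i = rowStartingWith L i := by
  rw [rowStartingWith, List.find?_cons_of_neg (by simpa using h)]
  rfl

/-- Strictly increasing first entries mean at most one row per starting value, in order. Restoring
the missing rows as empty ones therefore loses nothing; the offset a serves the induction. -/
theorem eq_filter_rowStartingWith {n a : ℕ} {L : List (List ℕ)} (h1 : ∀ r ∈ L, r ≠ [])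
    (h2 : L.Pairwise fun r r' => r.headD 0 < r'.headD 0)
    (h3 : ∀ r ∈ L, a < r.headD 0 ∧ r.headD 0 ≤ a + n) :
    L = ((List.range n).map fun i => rowStartingWith L (a + i + 1)).filter (· ≠ []) := by
  have hhead : ∀ r : List ℕ, r ≠ [] → ∀ i, (r.head? = some i ↔ r.headD 0 = i) := by
    intro r hr i
    cases r with
    | nil => exact absurd rfl hr
    | cons x r => simp
  induction n generalizing a L with
  | zero =>
    cases L with
    | nil => rfl
    | cons r L => have := h3 r List.mem_cons_self; omega
  | succ n ih =>
    rw [List.range_succ_eq_map, List.map_cons, List.map_map]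
    have hshift : ((fun i => rowStartingWith L (a + i + 1)) ∘ Nat.succ) =
        fun i => rowStartingWith L (a + 1 + i + 1) := by
      funext i
      simp only [Function.comp, Nat.succ_eq_add_one]
      congr 1; omega
    by_cases hL : ∀ r ∈ L, a + 1 < r.headD 0
    · rw [rowStartingWith_eq_nil, hshift, List.filter_cons_of_neg (by simp)]
      · exact ih h1 h2 fun r hr => ⟨hL r hr, by have := h3 r hr; omega⟩
      · intro r hr
        rw [Ne, hhead r (h1 r hr)]
        have := hL r hr
        omega
    · cases L with
      | nil => simp at hL
      | cons r L =>
        obtain ⟨h4, h5⟩ := List.pairwise_cons.1 h2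
        have h6 : r.headD 0 = a + 1 := by
          by_contra hne
          apply hL
          have h7 := h3 r List.mem_cons_self
          intro r' hr'
          rcases List.mem_cons.1 hr' with rfl | hr'
          · omega
          · have := h4 r' hr'; omega
        have hr := h1 r List.mem_cons_self
        have h8 : (fun i => rowStartingWith (r :: L) (a + 1 + i + 1)) =
            fun i => rowStartingWith L (a + 1 + i + 1) := by
          funext i
          refine rowStartingWith_cons_of_ne ?_
          rw [Ne, hhead r hr]
          omega
        rw [hshift, h8, rowStartingWith_cons_self ((hhead r hr _).2 h6),
          List.filter_cons_of_pos (by simpa using hr),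
          ← ih (fun r' hr' => h1 r' (List.mem_cons_of_mem _ hr')) h5]
        intro r' hr'
        have := h4 r' hr'
        have := h3 r' (List.mem_cons_of_mem _ hr')
        omega

namespace SkewTableau

theorem ext_rows {α : Comp} {T T' : SkewTableau α} (h : T.rows = T'.rows) : T = T' := by
  cases T; cases T'; cases h; rfl

theorem block_succ (T : SkewTableau [1]) (i : ℕ) :
    T.block (i + 1) = rowStartingWith T.rows.tail (i + 1) := by
  rw [block, if_neg (by omega)]
  rfl

theorem rows_eq_cons (T : SkewTableau [1]) : T.rows = T.block 0 :: T.rows.tail := by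
  have h := T.length_le
  rw [block, if_pos rfl]
  cases hr : T.rows with
  | nil => rw [hr] at h; simp at h
  | cons r l => rfl

theorem mem_rows_of_block_ne_nil (T : SkewTableau [1]) {m : ℕ} (h : T.block m ≠ []) :
    T.block m ∈ T.rows := by
  rw [rows_eq_cons]
  cases m with
  | zero => exact List.mem_cons_self
  | succ m =>
    rw [block_succ] at h ⊢
    exact List.mem_cons_of_mem _ (rowStartingWith_mem h).1

theorem tail_eq (T : SkewTableau [1]) {n : ℕ} (hT : T.IsImmaculate)
    (hn : ∀ r ∈ T.rows, ∀ x ∈ r, x ≤ n) : T.rows.tail =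
      ((List.range n).map fun i => T.block (i + 1)).filter (· ≠ []) := by
  have hne : ∀ r ∈ T.rows.tail, r ≠ [] := by
    have := T.ne_nil
    rwa [List.length_singleton, List.drop_one] at this
  have h := eq_filter_rowStartingWith (n := n) (a := 0) (L := T.rows.tail) hne ?_ ?_
  · simpa only [block_succ, zero_add] using h
  · have := hT.2
    rw [List.length_singleton, List.drop_one] at this
    exact List.pairwise_map.1 this.pairwise
  · intro r hr
    have hmem := List.mem_of_mem_tail hr
    cases hl : r with
    | nil => exact absurd hl (hne r hr)
    | cons x l =>
      have hx : x ∈ r := by rw [hl]; exact List.mem_cons_self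
      have := T.entry_pos r hmem x hx
      have := hn r hmem x hx
      rw [List.headD_cons]
      omega

theorem rows_eq (T : SkewTableau [1]) {n : ℕ} (hT : T.IsImmaculate)
    (hn : ∀ r ∈ T.rows, ∀ x ∈ r, x ≤ n) : T.rows =
      T.block 0 :: ((List.range n).map fun i => T.block (i + 1)).filter (· ≠ []) := by
  rw [← tail_eq T hT hn]
  exact rows_eq_cons T

theorem sum_map_rows (T : SkewTableau [1]) {n : ℕ} (hT : T.IsImmaculate)
    (hn : ∀ r ∈ T.rows, ∀ x ∈ r, x ≤ n) (g : List ℕ → ℕ) (hg : g [] = 0) :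
    (T.rows.map g).sum = ∑ m ∈ Finset.range (n + 1), g (T.block m) := by
  rw [rows_eq T hT hn, List.map_cons, List.sum_cons, List.sum_map_filter_ne_nil g hg,
    List.map_map, List.sum_map_range_eq, Finset.sum_range_succ', add_comm]
  rfl

theorem content_eq (T : SkewTableau [1]) {n : ℕ} (hT : T.IsImmaculate)
    (hn : ∀ r ∈ T.rows, ∀ x ∈ r, x ≤ n) (i : ℕ) : T.content i = blockCount n T.block i := by
  rw [content, List.count_flatten, sum_map_rows T hT hn _ rfl, blockCount]

theorem isBlocks (T : SkewTableau [1]) {n : ℕ} (hT : T.IsImmaculate)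
    (hn : ∀ r ∈ T.rows, ∀ x ∈ r, x ≤ n) : IsBlocks n T.block where
  pairwise m _ := by
    by_cases h : T.block m = []
    · rw [h]; exact List.Pairwise.nil
    · exact (hT.1 _ (T.mem_rows_of_block_ne_nil h)).pairwise
  pos m _ x hx := T.entry_pos _ (T.mem_rows_of_block_ne_nil (List.ne_nil_of_mem hx)) x hx
  le_n m _ x hx := hn _ (T.mem_rows_of_block_ne_nil (List.ne_nil_of_mem hx)) x hx
  head m h1 _ hne := by
    obtain ⟨m, rfl⟩ : ∃ l, m = l + 1 := ⟨m - 1, by omega⟩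
    rw [block_succ] at hne ⊢
    exact (rowStartingWith_mem hne).2

theorem ext_block {T T' : SkewTableau [1]} {n : ℕ} (hT : T.IsImmaculate)
    (hn : ∀ r ∈ T.rows, ∀ x ∈ r, x ≤ n) (hT' : T'.IsImmaculate)
    (hn' : ∀ r ∈ T'.rows, ∀ x ∈ r, x ≤ n) (h : ∀ m ≤ n, T.block m = T'.block m) : T = T' := by
  apply ext_rows
  rw [rows_eq T hT hn, rows_eq T' hT' hn', h 0 (by omega)]
  congr 2
  refine List.map_congr_left fun i hi => h _ ?_
  have := List.mem_range.1 hi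
  omega

theorem mem_blockRows {n : ℕ} {f : ℕ → List ℕ} {r : List ℕ}
    (h : r ∈ ((List.range n).map fun i => f (i + 1)).filter (· ≠ [])) :
    ∃ m, 1 ≤ m ∧ m ≤ n ∧ r = f m ∧ f m ≠ [] := by
  obtain ⟨h1, h2⟩ := List.mem_filter.1 h
  obtain ⟨i, hi, rfl⟩ := List.mem_map.1 h1
  exact ⟨i + 1, by omega, by have := List.mem_range.1 hi; omega, rfl, by simpa using h2⟩

/-- The tableau with given blocks. -/
def ofBlocks {n : ℕ} {f : ℕ → List ℕ} (hf : IsBlocks n f) : SkewTableau [1] where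
  rows := f 0 :: ((List.range n).map fun i => f (i + 1)).filter (· ≠ [])
  entry_pos r hr x hx := by
    rcases List.mem_cons.1 hr with rfl | hr
    · exact hf.pos 0 (by omega) x hx
    · obtain ⟨m, -, h2, rfl, -⟩ := mem_blockRows hr
      exact hf.pos m h2 x hx
  length_le := by simp
  ne_nil r hr := by
    rw [List.length_singleton, List.drop_one, List.tail_cons] at hr
    obtain ⟨m, -, -, rfl, h⟩ := mem_blockRows hr
    exact h

section OfBlocks

variable {n : ℕ} {f : ℕ → List ℕ} (hf : IsBlocks n f)

theorem ofBlocks_entry_le : ∀ r ∈ (ofBlocks hf).rows, ∀ x ∈ r, x ≤ n := by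
  intro r hr x hx
  rcases List.mem_cons.1 hr with rfl | hr
  · exact hf.le_n 0 (by omega) x hx
  · obtain ⟨m, -, h2, rfl, -⟩ := mem_blockRows hr
    exact hf.le_n m h2 x hx

theorem isImmaculate_ofBlocks : (ofBlocks hf).IsImmaculate := by
  constructor
  · intro r hr
    rcases List.mem_cons.1 hr with rfl | hr
    · exact (hf.pairwise 0 (by omega)).sortedLE
    · obtain ⟨m, -, h2, rfl, -⟩ := mem_blockRows hr
      exact (hf.pairwise m h2).sortedLE
  · refine List.Pairwise.sortedLT ?_
    rw [List.length_singleton, List.drop_one, ofBlocks, List.tail_cons, List.pairwise_map,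
      List.pairwise_filter, List.pairwise_map]
    refine List.pairwise_lt_range.imp_of_mem fun {i j} hi hj hij h1 h2 => ?_
    have head : ∀ k ∈ List.range n, f (k + 1) ≠ [] → (f (k + 1)).headD 0 = k + 1 := by
      intro k hk hne
      have := hf.head (k + 1) (by omega) (by have := List.mem_range.1 hk; omega) hne
      cases hl : f (k + 1) with
      | nil => exact absurd hl hne
      | cons x l => rw [hl] at this; simpa using this
    rw [head i hi (by simpa using h1), head j hj (by simpa using h2)]
    omega

theorem block_ofBlocks {m : ℕ} (hm : m ≤ n) : (ofBlocks hf).block m = f m := by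
  cases m with
  | zero => rfl
  | succ m =>
    rw [block_succ]
    set L := (ofBlocks hf).rows.tail with hL
    have key : ∀ r ∈ L, r.head? = some (m + 1) → r = f (m + 1) := by
      intro r hr h
      obtain ⟨k, h1, h2, rfl, h3⟩ := mem_blockRows hr
      have := hf.head k h1 h2 h3
      rw [h] at this
      rw [Option.some_injective _ this]
    by_cases hne : f (m + 1) = []
    · rw [hne]
      refine rowStartingWith_eq_nil fun r hr h => ?_
      rw [key r hr h, hne] at h
      simp at h
    · by_cases h : rowStartingWith L (m + 1) = []
      · exfalso
        have hmem : f (m + 1) ∈ L := by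
          rw [hL, ofBlocks, List.tail_cons]
          exact List.mem_filter.2 ⟨List.mem_map.2 ⟨m, List.mem_range.2 (by omega), rfl⟩,
            by simpa using hne⟩
        have hh := hf.head (m + 1) (by omega) hm hne
        unfold rowStartingWith at h
        cases hfind : L.find? fun r => r.head? == some (m + 1) with
        | none =>
          have := List.find?_eq_none.1 hfind _ hmem
          simp [hh] at this
        | some r =>
          rw [hfind, Option.getD_some] at h
          have := List.find?_some hfind
          rw [h] at this
          simp at this
      · obtain ⟨h1, h2⟩ := rowStartingWith_mem h
        exact key _ h1 h2

end OfBlocks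

theorem delta_getD_zero (n : ℕ) (T : SkewTableau [1]) :
    (T.delta n).getD 0 0 = (T.block 0).length + 1 := rfl

theorem delta_getD_succ {n i : ℕ} (hi : i < n) (T : SkewTableau [1]) :
    (T.delta n).getD (i + 1) 0 = (T.block (i + 1)).length := by
  rw [delta, List.getD_cons_succ, List.getD_eq_getElem?_getD, List.getElem?_map,
    List.getElem?_range hi]
  rfl

theorem shape_eq (T : SkewTableau [1]) {n : ℕ} (hT : T.IsImmaculate)
    (hn : ∀ r ∈ T.rows, ∀ x ∈ r, x ≤ n) : T.shape = compOf (T.delta n) := by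
  have h0 : ∀ L : List (List ℕ),
      (L.mapIdx fun i r => Comp.part [1] (i + 1 + 1) + r.length) = L.map List.length := by
    intro L
    apply List.ext_getElem
    · simp
    · intro i h1 h2
      rw [List.getElem_mapIdx, List.getElem_map, Comp.part_of_gt (by simp), zero_add]
  rw [shape, rows_eq T hT hn, List.mapIdx_cons, h0, compOf, delta,
    List.filter_cons_of_pos (by simp), Comp.part_cons_one, add_comm]
  congr 1
  rw [← Function.comp_def List.length fun i => T.block (i + 1), ← List.map_map]
  generalize (List.range n).map (fun i => T.block (i + 1)) = L
  rw [List.filter_map]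
  congr 1
  refine List.filter_congr fun r _ => ?_
  simp

/-- The content differs from β by σ(i) - i, and these differences sum to 0 for a permutation. The
additional 1 is the empty cell. -/
theorem sum_delta {β : Comp} {T : SkewTableau [1]} (hT : T ∈ permTableaux [1] β) :
    (T.delta β.length).sum = β.size + 1 := by
  obtain ⟨h1, h2, π, hπ⟩ := hT
  have hlen : T.rows.flatten.length = ∑ i ∈ Finset.range β.length, T.content (i + 1) := by
    refine List.length_eq_sum_count fun x hx => ?_
    obtain ⟨r, hr, hx⟩ := List.mem_flatten.1 hx
    exact ⟨T.entry_pos r hr x hx, h2 r hr x hx⟩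
  have hsum : (T.delta β.length).sum = T.rows.flatten.length + 1 := by
    rw [List.length_flatten, sum_map_rows T h1 h2 List.length rfl, delta, List.sum_cons,
      List.sum_map_range_eq, Finset.sum_range_succ']
    omega
  have hsize : β.size = ∑ i ∈ Finset.range β.length, β.part (i + 1) := by
    rw [Comp.size, List.sum_eq_sum_getD, List.length_map]
    rfl
  have hperm : ∑ i : Fin β.length, ((π i : ℕ) : ℤ) = ∑ i : Fin β.length, ((i : ℕ) : ℤ) :=
    Equiv.sum_comp π fun i : Fin β.length => ((i : ℕ) : ℤ)
  have hcont : ∀ i : Fin β.length, (T.content (i + 1) : ℤ) = β.part (i + 1) + (π i : ℕ) - i := by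
    intro i
    have := hπ i
    rw [sigma] at this
    push_cast at this
    linarith
  rw [hsum, hlen, hsize]
  congr 1
  zify
  rw [Finset.sum_range, Finset.sum_range, Finset.sum_congr rfl fun i _ => hcont i,
    Finset.sum_sub_distrib, Finset.sum_add_distrib, hperm]
  ring

end SkewTableau

/-! ### The unique surviving tableau of a vector -/

/-- The data of the survival analysis that belong to `β` and `δ = (s + 1, δ')`. -/
def ExcessData.ofVec (β : Comp) (s : ℕ) (δ : List ℕ) (hlen : δ.length = β.length)
    (h : PieriVec s β δ) : ExcessData where
  n := β.length
  b := β.part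
  d := fun i => (s :: δ).getD i 0
  b_pos i h1 h2 := by
    obtain ⟨i, rfl⟩ : ∃ l, i = l + 1 := ⟨i - 1, by omega⟩
    exact Comp.part_pos (by omega)
  d_out i hi := List.getD_eq_default _ _ (by simp; omega)
  excess_end := by
    have h1 := h.sum_eq
    have h2 : β.size = ∑ i ∈ Finset.range β.length, β.part (i + 1) := by
      rw [Comp.size, List.sum_eq_sum_getD, List.length_map]
      rfl
    rw [List.sum_eq_sum_getD, hlen, h2] at h1
    rw [Finset.sum_Ico_eq_sum_range, Nat.add_sub_cancel, Finset.sum_sub_distrib]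
    simp only [add_comm 1, List.getD_cons_succ, List.getD_cons_zero]
    zify at h1
    linarith
  numeric i h1 h2 := by
    obtain ⟨i, rfl⟩ : ∃ l, i = l + 1 := ⟨i - 1, by omega⟩
    have h3 := ((pieriVec_iff hlen).1 h).2 i (by omega)
    have h4 : (((s :: δ).getD 0 0 : ℕ) : ℤ) +
        ∑ j ∈ Finset.Ico 1 (i + 1), (((s :: δ).getD j 0 : ℤ) - β.part j) =
        excessFrom s β δ i := by
      rw [excessFrom, Finset.sum_Ico_eq_sum_range, Nat.add_sub_cancel]
      simp [add_comm 1]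
    rw [h4]
    refine ⟨h3.1, h3.2.1, fun h5 => (h3.2.2 h5).imp_right fun h6 => ⟨h6.1, fun j hj hj' => ?_⟩⟩
    obtain ⟨j, rfl⟩ : ∃ l, j = l + 1 := ⟨j - 1, by omega⟩
    exact h6.2 j (by omega) (by omega)

section

variable {β : Comp} {s : ℕ} {δ : List ℕ} (hlen : δ.length = β.length) (h : PieriVec s β δ)

theorem ExcessData.excess_eq_Q (i : ℕ) :
    excess β ((s + 1) :: δ) i = (ExcessData.ofVec β s δ hlen h).Q i := by
  rw [excess, ExcessData.Q]
  congr 1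
  · change ((s + 1 : ℕ) : ℤ) - 1 = (s : ℕ)
    push_cast; ring
  · refine Finset.sum_congr rfl fun j hj => ?_
    have := Finset.mem_Ico.1 hj
    obtain ⟨j, rfl⟩ : ∃ l, j = l + 1 := ⟨j - 1, by omega⟩
    rfl

/-- `ExcessData` has s at index 0 where δ(T) has s + 1. That entry enters only through the excess,
which subtracts the 1. -/
theorem SkewTableau.survives_iff {T : SkewTableau [1]} (hT : T.delta β.length = (s + 1) :: δ) :
    T.Survives β ↔ (ExcessData.ofVec β s δ hlen h).BlocksSurvive T.block (T.sigma β) := by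
  unfold SkewTableau.Survives ExcessData.BlocksSurvive
  refine forall_congr' fun i => forall_congr' fun h1 => forall_congr' fun h2 => ?_
  unfold SkewTableau.CaseHigh SkewTableau.CaseZero SkewTableau.SigmaLow
    SkewTableau.OnlyInOwnBlock
  rw [hT, ExcessData.excess_eq_Q hlen h]
  obtain ⟨i, rfl⟩ : ∃ l, i = l + 1 := ⟨i - 1, by omega⟩
  have h3 : (∀ j, i + 1 < j → j ≤ β.length → β.part j = ((s + 1) :: δ).getD j 0 ∧
      T.sigma β j = j ∧ ∀ m ≤ β.length, m ≠ j → j ∉ T.block m) ↔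
      (∀ j, i + 1 < j → j ≤ β.length → β.part j = (s :: δ).getD j 0 ∧
      T.sigma β j = j ∧ ∀ m ≤ β.length, m ≠ j → j ∉ T.block m) := by
    refine forall_congr' fun j => forall_congr' fun hj => ?_
    obtain ⟨j, rfl⟩ : ∃ l, j = l + 1 := ⟨j - 1, by omega⟩
    rfl
  rw [h3]
  rfl

theorem SkewTableau.length_block_of_delta {T : SkewTableau [1]}
    (hT : T.delta β.length = (s + 1) :: δ) {m : ℕ} (hm : m ≤ β.length) :
    (T.block m).length = (ExcessData.ofVec β s δ hlen h).d m := by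
  cases m with
  | zero =>
    have := T.delta_getD_zero β.length
    rw [hT, List.getD_cons_zero] at this
    exact (Nat.succ_injective this).symm
  | succ m =>
    rw [← SkewTableau.delta_getD_succ (n := β.length) (by omega) T, hT]
    rfl

/-- The surviving tableau of a vector that satisfies the numerical conditions. -/
def survivor : SkewTableau [1] :=
  SkewTableau.ofBlocks (ExcessData.ofVec β s δ hlen h).isBlocks_canon

theorem delta_survivor : (survivor hlen h).delta β.length = (s + 1) :: δ := by
  set D := ExcessData.ofVec β s δ hlen h with hD
  have hb : ∀ m ≤ β.length, ((survivor hlen h).block m).length = D.d m := fun m hm => by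
    rw [survivor, SkewTableau.block_ofBlocks D.isBlocks_canon hm, D.length_canon hm]
  rw [SkewTableau.delta, hb 0 (by omega)]
  congr 1
  apply List.ext_getElem
  · simp [hlen]
  · intro i h1 h2
    rw [List.getElem_map, List.getElem_range, hb _ (by omega)]
    change δ.getD i 0 = _
    rw [List.getD_eq_getElem _ _ h2]

theorem sigma_survivor {i : ℕ} (h1 : 1 ≤ i) (h2 : i ≤ β.length) :
    (survivor hlen h).sigma β i = (ExcessData.ofVec β s δ hlen h).perm i := by
  set D := ExcessData.ofVec β s δ hlen h with hD
  have hc : blockCount β.length (survivor hlen h).block i = blockCount β.length D.canon i := by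
    unfold blockCount
    refine Finset.sum_congr rfl fun m hm => ?_
    rw [survivor, SkewTableau.block_ofBlocks D.isBlocks_canon
      (show m ≤ β.length by have := Finset.mem_range.1 hm; omega)]
  rw [SkewTableau.sigma, SkewTableau.content_eq (n := β.length) (survivor hlen h)
    (SkewTableau.isImmaculate_ofBlocks _) (SkewTableau.ofBlocks_entry_le D.isBlocks_canon), hc,
    ← D.perm_canon h1 h2]
  rfl

theorem exists_perm_survivor : ∃ π : Equiv.Perm (Fin β.length), (survivor hlen h).HasPerm β π ∧
    (Equiv.Perm.sign π : ℤ) = diffSign β δ := by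
  set D := ExcessData.ofVec β s δ hlen h with hD
  obtain ⟨π, h1, h2⟩ := D.exists_perm
  refine ⟨π, fun i => ?_, h2.trans ?_⟩
  · rw [sigma_survivor hlen h (by omega) (by omega), ← hD]
    have := h1 i
    omega
  · have key : ∀ (β : Comp) (δ : List ℕ), δ.length = β.length → diffSign β δ =
        ∏ i ∈ Finset.range β.length, if δ.getD i 0 ≤ β.part (i + 1) then 1 else -1 := by
      intro β
      induction β with
      | nil => intro δ _; cases δ <;> rfl
      | cons b β ih =>
        intro δ hδ
        cases δ with
        | nil => simp at hδ
        | cons d δ =>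
          rw [List.length_cons, Finset.prod_range_succ', diffSign, ih δ (by simpa using hδ),
            mul_comm]
          congr 1
          rw [List.getD_cons_zero, Comp.part_cons_one]
          split_ifs <;> omega
    exact (key β δ hlen).symm

theorem survivor_mem : survivor hlen h ∈ SkewTableau.permTableaux [1] β :=
  ⟨SkewTableau.isImmaculate_ofBlocks _, SkewTableau.ofBlocks_entry_le _,
    (exists_perm_survivor hlen h).imp fun _ hπ => hπ.1⟩

theorem survivor_survives : (survivor hlen h).Survives β := by
  set D := ExcessData.ofVec β s δ hlen h with hD
  rw [SkewTableau.survives_iff hlen h (delta_survivor hlen h), ← hD]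
  have h1 := D.blocksSurvive_canon (σ := (survivor hlen h).sigma β)
    fun i h1 h2 => sigma_survivor hlen h h1 h2
  have hb : ∀ m ≤ D.n, (survivor hlen h).block m = D.canon m := fun m hm =>
    SkewTableau.block_ofBlocks D.isBlocks_canon hm
  intro i hi hi'
  obtain ⟨a1, a2, a3⟩ := h1 i hi hi'
  refine ⟨fun a => ?_, fun a => ?_, fun a => ?_⟩
  · obtain ⟨b1, b2, b3⟩ := a1 a
    exact ⟨b1, b2, fun m hm => by rw [hb m hm]; exact b3 m hm⟩
  · obtain ⟨b1, b2, b3, b4⟩ := a2 a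
    exact ⟨b1, b2, b3, fun m hm => by rw [hb m (by omega)]; exact b4 m hm⟩
  · rcases a3 a with ⟨b1, b2, b3⟩ | ⟨b1, b2, b3⟩
    · exact Or.inl ⟨b1, b2, fun m hm => by rw [hb m hm]; exact b3 m hm⟩
    · exact Or.inr ⟨b1, b2, fun j hj hj' => ⟨(b3 j hj hj').1, (b3 j hj hj').2.1,
        fun m hm => by rw [hb m hm]; exact (b3 j hj hj').2.2 m hm⟩⟩

theorem eq_survivor {T : SkewTableau [1]} (h1 : T ∈ SkewTableau.permTableaux [1] β)
    (h2 : T.Survives β) (h3 : T.delta β.length = (s + 1) :: δ) : T = survivor hlen h := by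
  set D := ExcessData.ofVec β s δ hlen h with hD
  rw [SkewTableau.survives_iff hlen h h3, ← hD] at h2
  refine SkewTableau.ext_block h1.1 h1.2.1 (survivor_mem hlen h).1 (survivor_mem hlen h).2.1
    fun m hm => ?_
  rw [survivor, SkewTableau.block_ofBlocks D.isBlocks_canon hm]
  refine h2.eq_canon (T.isBlocks h1.1 h1.2.1)
    (fun m hm => SkewTableau.length_block_of_delta hlen h h3 hm) (fun i _ _ => ?_) hm
  rw [SkewTableau.sigma, T.content_eq h1.1 h1.2.1]
  rfl

end

theorem SkewTableau.Survives.numericConditions {β : Comp} {T : SkewTableau [1]}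
    (h : T.Survives β) : NumericConditions β (T.delta β.length) := by
  intro i h1 h2
  obtain ⟨a1, a2, a3⟩ := h i h1 h2
  refine ⟨fun a => (a1 a).1, fun a => ⟨(a2 a).1, (a2 a).2.1⟩, fun a => ?_⟩
  rcases a3 a with b | b
  · exact Or.inl b.1
  · exact Or.inr ⟨b.1, fun j hj hj' => (b.2.2 j hj hj').1⟩

/-! ### Assembling the Pieri rule -/

/-- Survival implies the inequalities, and the size condition comes from σ being a permutation.
Conversely `survivor` realises every admissible vector. -/
theorem mem_Zset_iff_pieriVec {β γ : Comp} {δ : List ℕ} : δ ∈ Zset β γ ↔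
    compOf δ = γ.map PNat.val ∧ ∃ s δ', δ = (s + 1) :: δ' ∧ PieriVec s β δ' := by
  refine and_congr_right fun _ => ?_
  constructor
  · rintro ⟨T, h1, h2, rfl⟩
    have hl : ((List.range β.length).map fun i => (T.block (i + 1)).length).length = β.length := by
      simp
    refine ⟨(T.block 0).length, _, rfl, ?_⟩
    exact (pieriVec_iff_numericConditions (d := (T.block 0).length + 1) (by omega) hl).2
      ⟨SkewTableau.sum_delta h1, h2.numericConditions⟩
  · rintro ⟨s, δ', rfl, h⟩
    exact ⟨survivor h.length_eq h, survivor_mem _ h, survivor_survives _ h, delta_survivor _ h⟩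

theorem mem_Zset_iff {β γ : Comp} {δ : List ℕ} : δ ∈ Zset β γ ↔
    δ.length = β.length + 1 ∧ 1 ≤ δ.getD 0 0 ∧ δ.sum = β.size + 1 ∧
      compOf δ = γ.map PNat.val ∧ NumericConditions β δ := by
  rw [mem_Zset_iff_pieriVec]
  constructor
  · rintro ⟨h1, s, δ', rfl, h2⟩
    have h3 := (pieriVec_iff_numericConditions (d := s + 1) (by omega) h2.length_eq).1 h2
    exact ⟨by simp [h2.length_eq], by simp, h3.1, h1, h3.2⟩
  · rintro ⟨h1, h2, h3, h4, h5⟩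
    cases δ with
    | nil => simp at h1
    | cons d δ =>
      rw [List.getD_cons_zero] at h2
      refine ⟨h4, d - 1, δ, by rw [Nat.sub_add_cancel h2], ?_⟩
      exact (pieriVec_iff_numericConditions h2 (by simpa using h1)).2 ⟨h3, h5⟩

theorem compOf_map_val (γ : Comp) : compOf (γ.map PNat.val) = γ.map PNat.val := by
  refine List.filter_eq_self.2 fun x hx => ?_
  obtain ⟨a, -, rfl⟩ := List.mem_map.1 hx
  simp

theorem compOf_padZero (γ : Comp) (k : ℕ) : compOf (padZero γ k) = γ.map PNat.val := by
  rw [compOf, padZero, List.filter_append, List.filter_cons_of_neg (by simp), ← List.filter_append,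
    List.take_append_drop]
  exact compOf_map_val γ

theorem map_val_mem_Zset_iff {β γ : Comp} (g : ℕ+) :
    (g :: γ : Comp).map PNat.val ∈ Zset β (g :: γ) ↔
      PieriVec (g - 1) β (γ.map PNat.val) := by
  have hg := g.pos
  rw [mem_Zset_iff_pieriVec, and_iff_right (compOf_map_val _), List.map_cons]
  constructor
  · rintro ⟨s, δ, h1, h2⟩
    obtain ⟨h3, rfl⟩ := List.cons.inj h1
    have h3 : (g : ℕ) = s + 1 := h3
    rwa [h3, Nat.add_sub_cancel]
  · intro h
    exact ⟨g - 1, _, by congr 1; omega, h⟩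

theorem padZero_mem_Zset_iff {β γ : Comp} (g : ℕ+) (k : ℕ) :
    padZero (g :: γ) (k + 1) ∈ Zset β (g :: γ) ↔
      PieriVec (g - 1) β (insertZero (γ.map PNat.val) k) := by
  have hg := g.pos
  rw [mem_Zset_iff_pieriVec, and_iff_right (compOf_padZero _ _)]
  have h0 : padZero (g :: γ) (k + 1) = (g : ℕ) :: insertZero (γ.map PNat.val) k := rfl
  rw [h0]
  constructor
  · rintro ⟨s, δ, h1, h2⟩
    obtain ⟨h3, rfl⟩ := List.cons.inj h1
    rwa [h3, Nat.add_sub_cancel]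
  · intro h
    exact ⟨g - 1, _, by congr 1; omega, h⟩

theorem length_insertZero (γ : List ℕ) (i : ℕ) : (insertZero γ i).length = γ.length + 1 := by
  simp [insertZero]; omega

theorem pieriTerm_eq_zero_of_length {q : ℕ} {β : Comp} {δ : List ℕ} (h : δ.length ≠ β.length) :
    pieriTerm q β δ = 0 := if_neg fun h' => h h'.length_eq

theorem structureConst_eq_pieriCoeff (β γ : Comp) :
    NSym.structureConst [1] β γ = (pieriCoeff β γ : ℚ) := by
  cases γ with
  | nil =>
    -- For empty γ, no vector is possible: its first entry s + 1 survives the removal of zeros.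
    rw [NSym.structureConst_one_nil, pieriCoeff, if_neg, if_neg, Int.cast_zero]
    · rintro ⟨-, -, h⟩
      obtain ⟨h1, s, δ, h2, -⟩ := mem_Zset_iff_pieriVec.1 h
      simp [h2, compOf] at h1
    · rintro ⟨h, -⟩
      simp at h
  | cons g γ =>
    rw [NSym.structureConst_one_cons, NSym.perpCoeff_eq]
    congr 1
    rw [pieriCoeff, map_val_mem_Zset_iff]
    have hl : (g :: γ : Comp).length = γ.length + 1 := rfl
    -- Admissible vectors have as many entries below the first as β. Hence either no zero is
    -- inserted, or exactly one is, or every term vanishes.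
    rcases eq_or_ne γ.length β.length with h1 | h1
    · rw [Finset.sum_eq_zero fun i _ => pieriTerm_eq_zero_of_length
        (by rw [length_insertZero, List.length_map]; omega), add_zero, pieriTerm,
        diffSign_eq_sgnVec (by simpa using h1)]
      by_cases hP : PieriVec (g - 1) β (γ.map PNat.val)
      · rw [if_pos hP, if_pos ⟨congrArg (· + 1) h1, hP⟩]
        rfl
      · rw [if_neg hP, if_neg fun h => hP h.2, if_neg fun h => ?_]
        have := h.1
        omega
    · rw [pieriTerm_eq_zero_of_length (by simpa using h1), zero_add,
        if_neg fun h => h1 (Nat.succ_injective h.1)]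
      rcases eq_or_ne (γ.length + 1) β.length with h2 | h2
      · have hk := kIndex_mem (β := β) (γ := g :: γ) (by omega)
        obtain ⟨k, hk'⟩ : ∃ k, kIndex β (g :: γ) = k + 1 :=
          ⟨kIndex β (g :: γ) - 1, by have := hk.1; omega⟩
        rw [sum_pieriTerm_insertZero _ g h2]
        have hd : γ.drop k = β.drop (k + 1) :=
          (drop_eq_drop_iff h2 g).2 fun j hj => hk.2.2 j (by omega)
        have hkl : k < β.length := by have := hk.2.1; omega
        rw [hk', padZero_mem_Zset_iff, Nat.add_sub_cancel, ← diffSign_insertZero g h2 hkl hd,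
          pieriTerm]
        by_cases hE : Even (rIndex β (g :: γ) - (k + 1))
        · by_cases hP : PieriVec (g - 1) β (insertZero (γ.map PNat.val) k)
          · rw [if_pos hE, if_pos hP, if_pos ⟨h2, hE, hP⟩]
          · rw [if_pos hE, if_neg hP, if_neg fun h => hP h.2.2]
        · rw [if_neg hE, if_neg fun h => hE h.2.1]
      · rw [if_neg fun h => h2 h.1]
        exact Finset.sum_eq_zero fun i _ => pieriTerm_eq_zero_of_length
          (by rw [length_insertZero, List.length_map]; exact h2)

theorem sgnVec_eq (v : List ℤ) : sgnVec v = 1 ∨ sgnVec v = -1 := neg_one_pow_eq_or ℤ _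

theorem pieriCoeff_eq (β γ : Comp) :
    pieriCoeff β γ = 0 ∨ pieriCoeff β γ = 1 ∨ pieriCoeff β γ = -1 := by
  unfold pieriCoeff
  split_ifs
  · exact Or.inr (sgnVec_eq _)
  · exact Or.inr (sgnVec_eq _)
  · exact Or.inl rfl

theorem mainTheorem2 (β : Comp) :
    -- the expansion in the immaculate basis, and its coefficients
    (NSym.immaculate [1] * NSym.immaculate β =
      (NSym.structureConst [1] β).sum fun γ c => c • NSym.immaculate γ) ∧
    (∀ γ : Comp, NSym.structureConst [1] β γ = (pieriCoeff β γ : ℚ)) ∧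
    -- multiplicity-freeness
    (∀ γ : Comp, NSym.structureConst [1] β γ = 0 ∨ NSym.structureConst [1] β γ = 1 ∨
      NSym.structureConst [1] β γ = -1) ∧
    -- membership in `Z_β^γ` in terms of inequalities
    (∀ (γ : Comp) (δ : List ℕ), δ ∈ Zset β γ ↔
      δ.length = β.length + 1 ∧ 1 ≤ δ.getD 0 0 ∧ δ.sum = β.size + 1 ∧
        compOf δ = γ.map PNat.val ∧ NumericConditions β δ) ∧
    -- each vector in `Z_β^γ` comes from exactly one tableau; its shape is `γ` and its
    -- sign is that of the difference of `β` and `δ`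
    (∀ (γ : Comp) (δ : List ℕ), δ ∈ Zset β γ →
      ∃ T : SkewTableau [1],
        (∀ T' : SkewTableau [1], (T' ∈ SkewTableau.permTableaux [1] β ∧ T'.Survives β ∧
          T'.delta β.length = δ) ↔ T' = T) ∧
        T.shape = γ.map PNat.val ∧
        ∃ π : Equiv.Perm (Fin β.length), T.HasPerm β π ∧
          (Equiv.Perm.sign π : ℤ) = sgnVec
            ((List.range β.length).map fun i =>
              (β.part (i + 1) : ℤ) - (δ.getD (i + 1) 0 : ℤ))) := by
  refine ⟨?_, structureConst_eq_pieriCoeff β, fun γ => ?_, fun γ δ => mem_Zset_iff, ?_⟩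
  · have h := NSym.immaculateBasis.linearCombination_repr
      (NSym.immaculate [1] * NSym.immaculate β)
    rw [Finsupp.linearCombination_apply] at h
    simp only [NSym.immaculateBasis_apply] at h
    exact h.symm
  · rw [structureConst_eq_pieriCoeff]
    exact_mod_cast pieriCoeff_eq β γ
  · intro γ δ hδ
    obtain ⟨hc, s, δ', rfl, h⟩ := mem_Zset_iff_pieriVec.1 hδ
    refine ⟨survivor h.length_eq h, fun T' => ⟨fun hT' => eq_survivor _ h hT'.1 hT'.2.1 hT'.2.2,
      ?_⟩, ?_, ?_⟩
    · rintro rfl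
      exact ⟨survivor_mem _ h, survivor_survives _ h, delta_survivor _ h⟩
    · rw [SkewTableau.shape_eq _ (survivor_mem _ h).1 (survivor_mem _ h).2.1, delta_survivor, hc]
    · obtain ⟨π, h1, h2⟩ := exists_perm_survivor h.length_eq h
      refine ⟨π, h1, h2.trans ?_⟩
      rw [diffSign_eq_sgnVec h.length_eq]
      rfl
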